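/- Let $Q=(q_1,\dots,q_k)$, $k\ge 1$, be a list of finite sequences of pairwise distinct bins, where every bin $b$ carries a pallet symbol $\mathrm{plt}(b)\in\mathbb N$ and every pallet that occurs has at least two bins in $Q$. Let $N=\max_j|q_j|$. A configuration is a vector $v=(v_1,\dots,v_k)$ with $0\le v_j\le|q_j|$, meaning that the first $v_j$ bins of each $q_j$ have been removed. A pallet is open in $v$ if at least one of its bins has been removed and at least one of its bins remains; $f(v)$ denotes the number of open pallets. A processing of $Q$ is a sequence of steps, each removing the first remaining bin of one sequence, that leads from $s=(0,\dots,0)$ to $t=(|q_1|,\dots,|q_k|)$. $Q$ can be processed with at most $p$ stack-up places if there is a processing of $Q$ in which every configuration has at most $p$ open pallets. The processing graph has all configurations as its vertices and an arc $(u,v)$ whenever $v$ arises from $u$ by increasing exactly one coordinate by $1$. Let $\mathrm{val}(v)$ be the minimum, over all paths from $s$ to $v$, of the maximum of $f$ on the path ($\infty$ if there is no path). Theorem. (a) For every such $Q$, the processing graph is acyclic and has at most $(N+1)^k$ vertices; $\mathrm{val}(s)=f(s)$, and $\mathrm{val}(v)=\max\{f(v),\min_{(u,v)\in E}\mathrm{val}(u)\}$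 for all vertices $v\neq s$, where $E$ is the set of arcs; and for every integer $p\ge1$, $Q$ can be processed with at most $p$ stack-up places if and only if $\mathrm{val}(t)\le p$. (b) There are a random access machine program (natural numbers as words; addition and truncated subtraction as the only arithmetic operations; memory outside the input initially $0$) and an absolute constant $C$ such that for all $k\ge1$, all such $Q$ and all $p\ge1$, the program, given $k$, $p$, the lengths $|q_1|,\dots,|q_k|$ and the pallet symbols of the bins in order, computes $\mathrm{val}(t)$ and decides whether $Q$ can be processed with at most $p$ stack-up places, in at most $C\cdot k\cdot(N+1)^k$ unit-cost steps. (c) For each fixed $k\ge 1$ the same program runs in polynomial time: its running time under the logarithmic cost measure (every operation costs the binary length of the number it yields, up to an additive constant) is bounded by a polynomial, depending only on $k$, in the number of bits of the input. -/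

import Mathlib

namespace StackUp

/-! ### The FIFO stack-up problem

A list of `k` sequences of bins is given by the pallet symbols of its bins: the `i`-th bin of
`q_j` is the position `i` of the list `Q j`, and the entry there is its pallet symbol. Bins are
positions, so they are pairwise distinct, also where their pallet symbols agree. -/

/-- The set of all pallets of the bins in `Q`. -/
def plts {k : ℕ} (Q : Fin k → List ℕ) : Finset ℕ :=
  Finset.univ.biUnion fun j => (Q j).toFinset

/-- The sequences of `Q` together contain at least two bins for each pallet. -/
def TwoBinsPerPallet {k : ℕ} (Q : Fin k → List ℕ) : Prop :=
  ∀ t ∈ plts Q, 2 ≤ ∑ j, (Q j).count t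

/-- The maximum sequence length `N`. -/
def maxLength {k : ℕ} (Q : Fin k → List ℕ) : ℕ :=
  Finset.univ.sup fun j => (Q j).length

/-- `(Q, Q')` is a configuration: `Q'` is obtained from `Q` by removing bins from the front of the
sequences. -/
def IsConfiguration {k : ℕ} (Q Q' : Fin k → List ℕ) : Prop :=
  ∀ j, Q' j <:+ Q j

/-- The pallets that are open in the configuration `(Q, Q')`: a bin for the pallet is contained in
some remaining sequence `Q' i`, and another one in some removed part `Q j - Q' j`. -/
def openPallets {k : ℕ} (Q Q' : Fin k → List ℕ) : Finset ℕ :=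
  (plts Q).filter fun t =>
    (∃ i, t ∈ Q' i) ∧ ∃ j, t ∈ (Q j).take ((Q j).length - (Q' j).length)

/-- A transformation step: the first bin of one of the remaining sequences is removed. -/
def TransformationStep {k : ℕ} (Q₁ Q₂ : Fin k → List ℕ) : Prop :=
  ∃ j, (∃ b, Q₁ j = b :: Q₂ j) ∧ ∀ l, l ≠ j → Q₂ l = Q₁ l

/-- `R 0, R 1, …, R n` is a processing of `Q`: `n` transformation steps that transform `Q` into
empty sequences. -/
def IsProcessing {k : ℕ} (Q : Fin k → List ℕ) (n : ℕ) (R : ℕ → Fin k → List ℕ) : Prop :=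
  R 0 = Q ∧ (∀ i < n, TransformationStep (R i) (R (i + 1))) ∧ (∀ j, R n j = []) ∧
    ∀ i ≤ n, IsConfiguration Q (R i)

/-- `Q` can be processed with at most `p` stack-up places: some processing of `Q` has at most `p`
open pallets in each of its configurations. -/
def CanBeProcessed {k : ℕ} (Q : Fin k → List ℕ) (p : ℕ) : Prop :=
  ∃ n R, IsProcessing Q n R ∧ ∀ i ≤ n, (openPallets Q (R i)).card ≤ p

/-! ### Min-max paths and the processing graph -/

/-- `P` is a (directed) path of `G` from `s` to `v`, listed by its vertices. -/
def IsPath {V : Type*} (G : Digraph V) (s v : V) (P : List V) : Prop :=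
  P.IsChain G.Adj ∧ P.head? = some s ∧ P.getLast? = some v

/-- The min-max value of `v`: the minimum, over all paths from `s` to `v`, of the maximum of the
vertex labels `f` on the path. It is `⊤` where `v` is not reachable from `s`. -/
noncomputable def minMaxValue {V : Type*} (G : Digraph V) (f : V → ℕ) (s v : V) : ℕ∞ :=
  ⨅ P ∈ {P : List V | IsPath G s v P}, ⨆ u ∈ P, (f u : ℕ∞)

/-- `G` has no directed cycle. -/
def Acyclic {V : Type*} (G : Digraph V) : Prop :=
  ∀ v, ¬ Relation.TransGen G.Adj v v

/-- The vertices of the processing graph: all vectors `(v_1, …, v_k)` with `0 ≤ v_j ≤ |q_j|`, where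
`v_j` is the number of bins that have been removed from `q_j`. -/
abbrev Vertex {k : ℕ} (Q : Fin k → List ℕ) : Type :=
  (j : Fin k) → Fin ((Q j).length + 1)

/-- The pallets `t` such that some bin for `t` has been removed and some bin for `t` remains when
the first `v_j` bins of each `q_j` have been removed. -/
def cut {k : ℕ} (Q : Fin k → List ℕ) (v : Vertex Q) : Finset ℕ :=
  (plts Q).filter fun t =>
    ∃ j j', t ∈ (Q j).take (v j) ∧ t ∈ (Q j').drop (v j')

/-- The processing graph: an arc removes exactly one bin. -/
def processingGraph {k : ℕ} (Q : Fin k → List ℕ) : Digraph (Vertex Q) where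
  Adj u v := ∃ j, (v j : ℕ) = (u j : ℕ) + 1 ∧ ∀ l, l ≠ j → v l = u l

/-- The initial configuration `(0, …, 0)`. -/
def source {k : ℕ} (Q : Fin k → List ℕ) : Vertex Q := fun _ => 0

/-- The final configuration `(|q_1|, …, |q_k|)`. -/
def target {k : ℕ} (Q : Fin k → List ℕ) : Vertex Q := fun j => Fin.last (Q j).length

/-- The value of a vertex of the processing graph: the min-max value for paths from the initial
configuration, where vertices are labeled by the number of open pallets. -/
noncomputable def val {k : ℕ} (Q : Fin k → List ℕ) (v : Vertex Q) : ℕ∞ :=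
  minMaxValue (processingGraph Q) (fun u => (cut Q u).card) (source Q) v

/-! ### Random access machine programs with a cost count

Structured programs for a random access machine with natural numbers as words, whose only
arithmetic operations are addition and (truncated) subtraction. A program uses finitely many
variables and arrays, named by numerals that are fixed in the program; arrays have no length and
all cells outside the input are initially `0`. -/

/-- A memory state: the values of the variables and the contents of the arrays. -/
@[ext] structure Store where
  var : ℕ → ℕ
  arr : ℕ → ℕ → ℕ

/-- The initial state on an input: array `0` holds the input, everything else is `0`. -/
def Store.init (inp : List ℕ) : Store where
  var _ := 0
  arr a i := if a = 0 then inp.getD i 0 else 0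

/-- The state after `x := n`. -/
def Store.setVar (s : Store) (x n : ℕ) : Store where
  var := Function.update s.var x n
  arr := s.arr

/-- The state after `a[i] := n`. -/
def Store.setArr (s : Store) (a i n : ℕ) : Store where
  var := s.var
  arr := Function.update s.arr a (Function.update (s.arr a) i n)

/-- Expressions: constants, variables, array cells `a[e]`, sums and truncated differences. -/
inductive Expr : Type where
  | const (n : ℕ)
  | var (x : ℕ)
  | cell (a : ℕ) (e : Expr)
  | add (e₁ e₂ : Expr)
  | sub (e₁ e₂ : Expr)

/-- The value of an expression. -/
def Expr.eval (s : Store) : Expr → ℕ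
  | .const n => n
  | .var x => s.var x
  | .cell a e => s.arr a (e.eval s)
  | .add e₁ e₂ => e₁.eval s + e₂.eval s
  | .sub e₁ e₂ => e₁.eval s - e₂.eval s

/-- The cost of evaluating an expression when an operation with result `n` costs `w n`. -/
def Expr.cost (w : ℕ → ℕ) (s : Store) : Expr → ℕ
  | .const n => w n
  | .var x => w (s.var x)
  | .cell a e => e.cost w s + w (s.arr a (e.eval s))
  | .add e₁ e₂ => e₁.cost w s + e₂.cost w s + w (e₁.eval s + e₂.eval s)
  | .sub e₁ e₂ => e₁.cost w s + e₂.cost w s + w (e₁.eval s - e₂.eval s)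

/-- Programs. `assign x e` is `x := e`, `store a i e` is `a[i] := e`, and `branch e₁ e₂ c d` and
`loop e₁ e₂ c` are `if e₁ < e₂ then c else d` and `while e₁ < e₂ do c`. -/
inductive Prog : Type where
  | skip
  | assign (x : ℕ) (e : Expr)
  | store (a : ℕ) (i e : Expr)
  | seq (c d : Prog)
  | branch (e₁ e₂ : Expr) (c d : Prog)
  | loop (e₁ e₂ : Expr) (c : Prog)

/-- `Exec w c s s' t`: started in the state `s`, the program `c` halts in the state `s'`, and the
run has total cost `t`, where an operation with result `n` costs `w n`, and every assignment, store
and test costs one more than the evaluation of its expressions. -/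
inductive Exec (w : ℕ → ℕ) : Prog → Store → Store → ℕ → Prop where
  | skip (s : Store) : Exec w .skip s s 1
  | assign (x : ℕ) (e : Expr) (s : Store) :
      Exec w (.assign x e) s (s.setVar x (e.eval s)) (e.cost w s + 1)
  | store (a : ℕ) (i e : Expr) (s : Store) :
      Exec w (.store a i e) s (s.setArr a (i.eval s) (e.eval s)) (i.cost w s + e.cost w s + 1)
  | seq {c d : Prog} {s s' s'' : Store} {t t' : ℕ} :
      Exec w c s s' t → Exec w d s' s'' t' → Exec w (.seq c d) s s'' (t + t')
  | branch_true {e₁ e₂ : Expr} {c : Prog} (d : Prog) {s s' : Store} {t : ℕ} :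
      e₁.eval s < e₂.eval s → Exec w c s s' t →
        Exec w (.branch e₁ e₂ c d) s s' (e₁.cost w s + e₂.cost w s + 1 + t)
  | branch_false {e₁ e₂ : Expr} (c : Prog) {d : Prog} {s s' : Store} {t : ℕ} :
      ¬ e₁.eval s < e₂.eval s → Exec w d s s' t →
        Exec w (.branch e₁ e₂ c d) s s' (e₁.cost w s + e₂.cost w s + 1 + t)
  | loop_true {e₁ e₂ : Expr} {c : Prog} {s s' s'' : Store} {t t' : ℕ} :
      e₁.eval s < e₂.eval s → Exec w c s s' t → Exec w (.loop e₁ e₂ c) s' s'' t' →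
        Exec w (.loop e₁ e₂ c) s s'' (e₁.cost w s + e₂.cost w s + 1 + t + t')
  | loop_false {e₁ e₂ : Expr} (c : Prog) {s : Store} :
      ¬ e₁.eval s < e₂.eval s → Exec w (.loop e₁ e₂ c) s s (e₁.cost w s + e₂.cost w s + 1)

/-- The semantics is deterministic: the final state and the cost are determined. -/
theorem Exec.deterministic {w : ℕ → ℕ} {c : Prog} {s s₁ s₂ : Store} {t₁ t₂ : ℕ}
    (h₁ : Exec w c s s₁ t₁) (h₂ : Exec w c s s₂ t₂) : s₁ = s₂ ∧ t₁ = t₂ := by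
  induction h₁ generalizing s₂ t₂ with
  | skip s => cases h₂; exact ⟨rfl, rfl⟩
  | assign x e s => cases h₂; exact ⟨rfl, rfl⟩
  | store a i e s => cases h₂; exact ⟨rfl, rfl⟩
  | seq _ _ ih ih' =>
    cases h₂ with
    | seq k k' =>
      obtain ⟨rfl, rfl⟩ := ih k
      obtain ⟨rfl, rfl⟩ := ih' k'
      exact ⟨rfl, rfl⟩
  | branch_true d h _ ih =>
    cases h₂ with
    | branch_true _ _ k => obtain ⟨rfl, rfl⟩ := ih k; exact ⟨rfl, rfl⟩
    | branch_false _ h' _ => exact absurd h h'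
  | branch_false c h _ ih =>
    cases h₂ with
    | branch_true _ h' _ => exact absurd h' h
    | branch_false _ _ k => obtain ⟨rfl, rfl⟩ := ih k; exact ⟨rfl, rfl⟩
  | loop_true h _ _ ih ih' =>
    cases h₂ with
    | loop_true _ k k' =>
      obtain ⟨rfl, rfl⟩ := ih k
      obtain ⟨rfl, rfl⟩ := ih' k'
      exact ⟨rfl, rfl⟩
    | loop_false _ h' => exact absurd h h'
  | loop_false c h =>
    cases h₂ with
    | loop_true h' _ _ => exact absurd h' h
    | loop_false _ _ => exact ⟨rfl, rfl⟩

/-- Uniform cost: every operation costs `1`, so the cost of a run is its number of steps. -/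
def uniformCost : ℕ → ℕ := fun _ => 1

/-- Logarithmic cost: an operation costs the length of the binary representation of its result
(plus one, so that no operation is free). The machine has no multiplication, and its
logarithmic-cost time is polynomially related to Turing machine time. -/
def logCost : ℕ → ℕ := fun n => Nat.size n + 1

/-- On the input `inp`, the program `c` halts with cost at most `T` in a state with `post`. -/
def Prog.HaltsWithin (c : Prog) (w : ℕ → ℕ) (inp : List ℕ) (T : ℕ) (post : Store → Prop) : Prop :=
  ∃ s t, Exec w c (Store.init inp) s t ∧ t ≤ T ∧ post s

/-- The instance `(Q, p)` as a list of numbers: `k`, `p`, the lengths of the sequences, and then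
the pallet symbols of the bins, one sequence after the other. -/
def encode {k : ℕ} (Q : Fin k → List ℕ) (p : ℕ) : List ℕ :=
  k :: p :: (List.ofFn (fun j => (Q j).length) ++ (List.ofFn Q).flatten)

/-- The size of an input in bits: the numbers in binary, with a separator after each of them. -/
def bitSize (inp : List ℕ) : ℕ := (inp.map fun n => Nat.size n + 1).sum

/-- The final state answers the question for `(Q, p)`: variable `0` holds `1` if `Q` can be
processed with at most `p` stack-up places and `0` otherwise, and variable `1` holds the min-max
value of the final configuration. -/
def Answers {k : ℕ} (Q : Fin k → List ℕ) (p : ℕ) (s : Store) : Prop :=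
  (CanBeProcessed Q p → s.var 0 = 1) ∧ (¬ CanBeProcessed Q p → s.var 0 = 0) ∧
    (s.var 1 : ℕ∞) = val Q (target Q)

end StackUp

/-!
The min-max value of a vertex obeys an optimality equation, because a path to a vertex `v` other
than the start is a path to a predecessor of `v` followed by `v` (`minMaxValue_eq_max`). Processings
of `Q` and paths of the processing graph are the same thing, read as remaining sequences or as
numbers of removed bins, so that the value of the final configuration decides the problem
(`canBeProcessed_iff`).

The program `solve` evaluates the optimality equation for all configurations. These are numbered in
the mixed-radix system with the digits `0, …, |q_j|` at place `j` and visited in increasing order.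
A predecessor of a configuration arises by lowering one digit by `1`, so its number is smaller by
the place value of that digit, and its value is already known. The program keeps the number of removed
bins for every pallet and the number of open pallets. Both are updated in constant time when a
single bin is removed or put back (`runs_removeBin`, `runs_restoreBin`). Passing to the next
configuration may reset digits, each of which puts a whole sequence back bin by bin. With the sum of
all digits as potential, this costs only `O(k)` amortized per configuration (`runs_advance`), which
is also the cost of the minimum over at most `k` predecessors (`runs_evaluate`). The tables for the
input are computed in time linear in `k` and the number of bins, and there are at most `(N + 1) ^ k`
configurations, so the total is `O(k (N + 1) ^ k)` (`solve_haltsWithin`).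

The logarithmic cost needs no further analysis of the program. As addition and subtraction are the
only operations, every step lengthens the numbers in the memory by at most one binary digit. A run
of `T` unit-cost steps on an input of `b` bits therefore has logarithmic cost at most
`T (b + O(1) + T)` (`Prog.HaltsWithin.logCost`), which for fixed `k` is a polynomial in `b`.
-/

namespace StackUp

/-! ### Cost-annotated runs -/

/-- `Runs c s R`: started in `s`, the program `c` halts, and its final state and its number of
unit-cost steps satisfy `R`. This is the weakest precondition of `c` for `R`. -/
def Runs (c : Prog) (s : Store) (R : Store → ℕ → Prop) : Prop :=
  ∃ s' t, Exec uniformCost c s s' t ∧ R s' t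

theorem Runs.mono {c : Prog} {s : Store} {R R' : Store → ℕ → Prop} (h : Runs c s R)
    (hR : ∀ s' t, R s' t → R' s' t) : Runs c s R' := by
  obtain ⟨s', t, he, hr⟩ := h
  exact ⟨s', t, he, hR _ _ hr⟩

theorem runs_skip {s : Store} {R : Store → ℕ → Prop} : Runs .skip s R ↔ R s 1 := by
  constructor
  · rintro ⟨s', t, he, hr⟩
    cases he
    exact hr
  · exact fun h => ⟨_, _, .skip s, h⟩

theorem runs_assign {x : ℕ} {e : Expr} {s : Store} {R : Store → ℕ → Prop} :
    Runs (.assign x e) s R ↔ R (s.setVar x (e.eval s)) (e.cost uniformCost s + 1) := by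
  constructor
  · rintro ⟨s', t, he, hr⟩
    cases he
    exact hr
  · exact fun h => ⟨_, _, .assign x e s, h⟩

theorem runs_store {a : ℕ} {i e : Expr} {s : Store} {R : Store → ℕ → Prop} :
    Runs (.store a i e) s R ↔
      R (s.setArr a (i.eval s) (e.eval s)) (i.cost uniformCost s + e.cost uniformCost s + 1) := by
  constructor
  · rintro ⟨s', t, he, hr⟩
    cases he
    exact hr
  · exact fun h => ⟨_, _, .store a i e s, h⟩

theorem runs_seq {c d : Prog} {s : Store} {R : Store → ℕ → Prop} :
    Runs (.seq c d) s R ↔ Runs c s fun s' t => Runs d s' fun s'' t' => R s'' (t + t') := by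
  constructor
  · rintro ⟨s', t, he, hr⟩
    cases he with
    | seq h h' => exact ⟨_, _, h, _, _, h', hr⟩
  · rintro ⟨s', t, h, s'', t', h', hr⟩
    exact ⟨_, _, .seq h h', hr⟩

theorem runs_branch {e₁ e₂ : Expr} {c d : Prog} {s : Store} {R : Store → ℕ → Prop} :
    Runs (.branch e₁ e₂ c d) s R ↔
      (e₁.eval s < e₂.eval s → Runs c s fun s' t =>
        R s' (e₁.cost uniformCost s + e₂.cost uniformCost s + 1 + t)) ∧
      (¬ e₁.eval s < e₂.eval s → Runs d s fun s' t =>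
        R s' (e₁.cost uniformCost s + e₂.cost uniformCost s + 1 + t)) := by
  constructor
  · rintro ⟨s', t, he, hr⟩
    cases he with
    | branch_true _ h h' => exact ⟨fun _ => ⟨_, _, h', hr⟩, fun hn => absurd h hn⟩
    | branch_false _ h h' => exact ⟨fun hp => absurd hp h, fun _ => ⟨_, _, h', hr⟩⟩
  · rintro ⟨h₁, h₂⟩
    by_cases h : e₁.eval s < e₂.eval s
    · obtain ⟨s', t, he, hr⟩ := h₁ h
      exact ⟨_, _, .branch_true _ h he, hr⟩
    · obtain ⟨s', t, he, hr⟩ := h₂ h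
      exact ⟨_, _, .branch_false _ h he, hr⟩

/-- Amortized analysis of a loop: if every iteration preserves the invariant `I` and is paid for by
the decrease of the potential `Φ`, then the loop halts, and up to the cost of the last test the
whole run is paid for by the decrease of `Φ`. -/
theorem runs_loop {e₁ e₂ : Expr} {c : Prog} (I : Store → Prop) (Φ : Store → ℕ)
    (hbody : ∀ s, I s → e₁.eval s < e₂.eval s → Runs c s fun s' t =>
      I s' ∧ e₁.cost uniformCost s + e₂.cost uniformCost s + 1 + t + Φ s' ≤ Φ s)
    {s : Store} (hs : I s) :
    Runs (.loop e₁ e₂ c) s fun s' t => I s' ∧ ¬ e₁.eval s' < e₂.eval s' ∧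
      t + Φ s' ≤ Φ s + (e₁.cost uniformCost s' + e₂.cost uniformCost s' + 1) := by
  induction hn : Φ s using Nat.strong_induction_on generalizing s with
  | _ n ih =>
    by_cases h : e₁.eval s < e₂.eval s
    · obtain ⟨s', t, he, hI, ht⟩ := hbody s hs h
      obtain ⟨s'', t', he', hI', hn', ht'⟩ := ih (Φ s') (by omega) hI rfl
      exact ⟨_, _, .loop_true h he he', hI', hn', by omega⟩
    · exact ⟨_, _, .loop_false _ h, hs, h, by omega⟩

/-! ### Memory access -/

@[simp] theorem Store.setVar_var (s : Store) (x n y : ℕ) :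
    (s.setVar x n).var y = if y = x then n else s.var y := Function.update_apply _ _ _ _

@[simp] theorem Store.setVar_arr (s : Store) (x n : ℕ) : (s.setVar x n).arr = s.arr := rfl

@[simp] theorem Store.setArr_var (s : Store) (a i n : ℕ) : (s.setArr a i n).var = s.var := rfl

@[simp] theorem Store.setArr_arr (s : Store) (a i n b l : ℕ) :
    (s.setArr a i n).arr b l = if b = a ∧ l = i then n else s.arr b l := by
  by_cases hb : b = a
  · subst hb
    simp [Store.setArr, Function.update_apply]
  · simp [Store.setArr, hb]

/-! ### Logarithmic cost against unit cost -/

/-- All numbers in the memory have at most `b` binary digits. -/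
def Store.Bounded (s : Store) (b : ℕ) : Prop :=
  (∀ x, s.var x < 2 ^ b) ∧ ∀ a i, s.arr a i < 2 ^ b

theorem Store.Bounded.mono {s : Store} {b b' : ℕ} (h : s.Bounded b) (hb : b ≤ b') :
    s.Bounded b' :=
  have := Nat.pow_le_pow_right (n := 2) (by norm_num) hb
  ⟨fun x => (h.1 x).trans_le this, fun a i => (h.2 a i).trans_le this⟩

theorem Store.Bounded.setVar {s : Store} {b n : ℕ} (h : s.Bounded b) (hn : n < 2 ^ b) (x : ℕ) :
    (s.setVar x n).Bounded b := by
  refine ⟨fun y => ?_, h.2⟩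
  simp only [Store.setVar, Function.update_apply]
  split_ifs
  exacts [hn, h.1 y]

theorem Store.Bounded.setArr {s : Store} {b n : ℕ} (h : s.Bounded b) (hn : n < 2 ^ b) (a i : ℕ) :
    (s.setArr a i n).Bounded b := by
  refine ⟨h.1, fun a' i' => ?_⟩
  simp only [Store.setArr, Function.update_apply]
  split_ifs
  · simp only [Function.update_apply]
    split_ifs
    exacts [hn, h.2 _ _]
  · exact h.2 _ _

/-- A number of binary digits that suffices for the constants of the expression. -/
def Expr.constBits : Expr → ℕ
  | .const n => n.size
  | .var _ => 0
  | .cell _ e => e.constBits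
  | .add e₁ e₂ => max e₁.constBits e₂.constBits
  | .sub e₁ e₂ => max e₁.constBits e₂.constBits

/-- A number of binary digits that suffices for the constants of the program. -/
def Prog.constBits : Prog → ℕ
  | .skip => 0
  | .assign _ e => e.constBits
  | .store _ i e => max i.constBits e.constBits
  | .seq c d => max c.constBits d.constBits
  | .branch e₁ e₂ c d => max (max e₁.constBits e₂.constBits) (max c.constBits d.constBits)
  | .loop e₁ e₂ c => max (max e₁.constBits e₂.constBits) c.constBits

theorem logCost_le {n b : ℕ} (h : n < 2 ^ b) : logCost n ≤ b + 1 :=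
  Nat.succ_le_succ (Nat.size_le.2 h)

/-- An operation makes a number at most one binary digit longer than its operands. -/
theorem Expr.eval_lt_and_logCost_le {s : Store} {b : ℕ} (hs : s.Bounded b) (e : Expr)
    (hb : e.constBits ≤ b) :
    e.eval s < 2 ^ (b + e.cost uniformCost s - 1) ∧ 1 ≤ e.cost uniformCost s ∧
      e.cost logCost s ≤ e.cost uniformCost s * (b + e.cost uniformCost s) := by
  induction e with
  | const n =>
    have : n < 2 ^ b := Nat.size_le.1 hb
    exact ⟨this, le_rfl, by simpa [Expr.cost, uniformCost] using logCost_le this⟩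
  | var x =>
    exact ⟨hs.1 x, le_rfl, by simpa [Expr.cost, uniformCost] using logCost_le (hs.1 x)⟩
  | cell a e ih =>
    obtain ⟨h₁, h₂, h₃⟩ := ih hb
    have h := hs.2 a (e.eval s)
    have hl := logCost_le h
    refine ⟨h.trans_le (Nat.pow_le_pow_right (by norm_num) ?_), ?_, ?_⟩ <;>
      simp only [Expr.cost, uniformCost] at *
    · omega
    · omega
    · nlinarith
  | add e₁ e₂ ih₁ ih₂ =>
    obtain ⟨h₁, h₂, h₃⟩ := ih₁ ((le_max_left _ _).trans hb)
    obtain ⟨k₁, k₂, k₃⟩ := ih₂ ((le_max_right _ _).trans hb)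
    have h : e₁.eval s + e₂.eval s <
        2 ^ (b + e₁.cost uniformCost s + e₂.cost uniformCost s - 1) := by
      have e₁' := Nat.pow_le_pow_right (n := 2) (by norm_num)
        (show b + e₁.cost uniformCost s - 1
          ≤ b + e₁.cost uniformCost s + e₂.cost uniformCost s - 2 by omega)
      have e₂' := Nat.pow_le_pow_right (n := 2) (by norm_num)
        (show b + e₂.cost uniformCost s - 1
          ≤ b + e₁.cost uniformCost s + e₂.cost uniformCost s - 2 by omega)
      have : 2 ^ (b + e₁.cost uniformCost s + e₂.cost uniformCost s - 1) =
          2 * 2 ^ (b + e₁.cost uniformCost s + e₂.cost uniformCost s - 2) := by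
        rw [← pow_succ']
        congr 1
        omega
      omega
    have hl := logCost_le h
    refine ⟨h.trans_le (Nat.pow_le_pow_right (by norm_num) ?_), ?_, ?_⟩ <;>
      simp only [Expr.cost] at *
    · omega
    · omega
    · generalize e₁.cost uniformCost s = x at *
      generalize e₂.cost uniformCost s = y at *
      simp only [uniformCost]
      have : b + x + y - 1 + 1 = b + x + y := by omega
      rw [this] at hl
      nlinarith
  | sub e₁ e₂ ih₁ ih₂ =>
    obtain ⟨h₁, h₂, h₃⟩ := ih₁ ((le_max_left _ _).trans hb)
    obtain ⟨k₁, k₂, k₃⟩ := ih₂ ((le_max_right _ _).trans hb)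
    have h := (Nat.sub_le (e₁.eval s) (e₂.eval s)).trans_lt h₁
    have hl := logCost_le h
    refine ⟨h.trans_le (Nat.pow_le_pow_right (by norm_num) ?_), ?_, ?_⟩ <;>
      simp only [Expr.cost] at *
    · omega
    · omega
    · generalize e₁.cost uniformCost s = x at *
      generalize e₂.cost uniformCost s = y at *
      simp only [uniformCost]
      have : b + x - 1 + 1 = b + x := by omega
      rw [this] at hl
      nlinarith

theorem Expr.eval_lt {s : Store} {b : ℕ} (hs : s.Bounded b) (e : Expr) (hb : e.constBits ≤ b) :
    e.eval s < 2 ^ (b + e.cost uniformCost s) :=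
  (e.eval_lt_and_logCost_le hs hb).1.trans_le (Nat.pow_le_pow_right (by norm_num) (by omega))

theorem Expr.logCost_le {s : Store} {b : ℕ} (hs : s.Bounded b) (e : Expr)
    (hb : e.constBits ≤ b) :
    e.cost logCost s ≤ e.cost uniformCost s * (b + e.cost uniformCost s) :=
  (e.eval_lt_and_logCost_le hs hb).2.2

/-- A run of `t` unit-cost steps that starts with numbers of at most `b` binary digits only handles
numbers of at most `b + t` digits, since every step adds at most one digit. Its logarithmic cost is
therefore at most quadratic in `t`. -/
theorem Exec.exists_logCost {c : Prog} {s s' : Store} {t : ℕ} (h : Exec uniformCost c s s' t)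
    {b : ℕ} (hb : 1 ≤ b) (hs : s.Bounded b) (hc : c.constBits ≤ b) :
    s'.Bounded (b + t) ∧ ∃ t', Exec logCost c s s' t' ∧ t' ≤ t * (b + t) := by
  induction h generalizing b with
  | skip s => exact ⟨hs.mono (by omega), _, .skip s, by nlinarith⟩
  | assign x e s =>
    have h₁ := e.eval_lt hs hc
    have h₂ := e.logCost_le hs hc
    exact ⟨((hs.mono (by omega)).setVar h₁ x).mono (by omega), _, .assign x e s, by nlinarith⟩
  | store a i e s =>
    have h₁ := e.eval_lt hs ((le_max_right _ _).trans hc)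
    have h₂ := e.logCost_le hs ((le_max_right _ _).trans hc)
    have h₃ := i.logCost_le hs ((le_max_left _ _).trans hc)
    exact ⟨((hs.mono (by omega)).setArr h₁ a _).mono (by omega), _, .store a i e s, by nlinarith⟩
  | @seq c d s s' s'' t t' _ _ ih ih' =>
    obtain ⟨h₁, u, h₂, h₃⟩ := ih hb hs ((le_max_left _ _).trans hc)
    obtain ⟨k₁, u', k₂, k₃⟩ := ih' (b := b + t) (by omega) h₁
      (((le_max_right _ _).trans hc).trans (by omega))
    exact ⟨k₁.mono (by omega), _, .seq h₂ k₂, by nlinarith⟩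
  | @branch_true e₁ e₂ c d s s' t h _ ih =>
    simp only [Prog.constBits, max_le_iff] at hc
    obtain ⟨h₁, u, h₂, h₃⟩ := ih hb hs hc.2.1
    have := e₁.logCost_le hs hc.1.1
    have := e₂.logCost_le hs hc.1.2
    exact ⟨h₁.mono (by omega), _, .branch_true _ h h₂, by nlinarith⟩
  | @branch_false e₁ e₂ c d s s' t h _ ih =>
    simp only [Prog.constBits, max_le_iff] at hc
    obtain ⟨h₁, u, h₂, h₃⟩ := ih hb hs hc.2.2
    have := e₁.logCost_le hs hc.1.1
    have := e₂.logCost_le hs hc.1.2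
    exact ⟨h₁.mono (by omega), _, .branch_false _ h h₂, by nlinarith⟩
  | @loop_true e₁ e₂ c s s' s'' t t' h _ _ ih ih' =>
    have hc' := hc
    simp only [Prog.constBits, max_le_iff] at hc
    obtain ⟨h₁, u, h₂, h₃⟩ := ih hb hs hc.2
    obtain ⟨k₁, u', k₂, k₃⟩ := ih' (b := b + t) (by omega) h₁ (hc'.trans (by omega))
    have l₁ := e₁.logCost_le hs hc.1.1
    have l₂ := e₂.logCost_le hs hc.1.2
    exact ⟨k₁.mono (by omega), _, .loop_true h h₂ k₂, by nlinarith⟩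
  | @loop_false e₁ e₂ c s h =>
    simp only [Prog.constBits, max_le_iff] at hc
    have := e₁.logCost_le hs hc.1.1
    have := e₂.logCost_le hs hc.1.2
    exact ⟨hs.mono (by omega), _, .loop_false _ h, by nlinarith⟩

theorem size_le_bitSize {inp : List ℕ} {n : ℕ} (h : n ∈ inp) : n.size ≤ bitSize inp :=
  (Nat.le_succ _).trans
    (List.single_le_sum (fun _ _ => Nat.zero_le _) _
      (List.mem_map_of_mem (f := fun n => Nat.size n + 1) h))

theorem length_le_bitSize (inp : List ℕ) : inp.length ≤ bitSize inp := by
  induction inp with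
  | nil => simp [bitSize]
  | cons a l ih =>
    simp only [bitSize, List.length_cons, List.map_cons, List.sum_cons] at *
    omega

theorem Store.bounded_init (inp : List ℕ) : (Store.init inp).Bounded (bitSize inp) := by
  refine ⟨fun x => by simp [Store.init], fun a i => ?_⟩
  simp only [Store.init]
  split_ifs
  · rcases lt_or_ge i inp.length with h | h
    · rw [List.getD_eq_getElem _ _ h]
      exact Nat.size_le.1 (size_le_bitSize (List.getElem_mem h))
    · rw [List.getD_eq_default _ _ h]
      positivity
  · positivity

/-- The logarithmic cost of a program is at most quadratic in its unit cost and the number of bits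
of the input. -/
theorem Prog.HaltsWithin.logCost {c : Prog} {inp : List ℕ} {T : ℕ} {post : Store → Prop}
    (h : c.HaltsWithin uniformCost inp T post) :
    c.HaltsWithin logCost inp (T * (bitSize inp + c.constBits + 1 + T)) post := by
  obtain ⟨s, t, he, ht, hp⟩ := h
  obtain ⟨-, t', he', ht'⟩ := he.exists_logCost (b := bitSize inp + c.constBits + 1) (by omega)
    ((Store.bounded_init inp).mono (by omega)) (by omega)
  exact ⟨s, t', he', ht'.trans (by gcongr), hp⟩

/-! ### Min-max values of directed paths -/

section MinMax

variable {V : Type*} {G : Digraph V} {f : V → ℕ} {s u v : V}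

theorem minMaxValue_le_of_isPath {P : List V} (hP : IsPath G s v P) :
    minMaxValue G f s v ≤ ⨆ u ∈ P, (f u : ℕ∞) :=
  iInf₂_le (f := fun (P : List V) (_ : P ∈ {P | IsPath G s v P}) => ⨆ u ∈ P, (f u : ℕ∞)) P hP

theorem IsPath.end_mem {P : List V} (hP : IsPath G s v P) : v ∈ P :=
  List.mem_of_getLast? hP.2.2

theorem le_minMaxValue : (f v : ℕ∞) ≤ minMaxValue G f s v :=
  le_iInf₂ fun _ hP => le_iSup₂ (f := fun u _ => (f u : ℕ∞)) v (IsPath.end_mem hP)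

theorem minMaxValue_self : minMaxValue G f s s = f s := by
  refine le_antisymm ?_ le_minMaxValue
  have h : IsPath G s s [s] := ⟨by simp, rfl, rfl⟩
  simpa using minMaxValue_le_of_isPath (f := f) h

theorem IsPath.concat {P : List V} (hP : IsPath G s u P) (h : G.Adj u v) :
    IsPath G s v (P ++ [v]) := by
  refine ⟨hP.1.append (by simp) ?_, ?_, by simp⟩
  · intro x hx y hy
    rw [hP.2.2] at hx
    simp only [Option.mem_def, Option.some.injEq, List.head?_cons] at hx hy
    exact hx ▸ hy ▸ h
  · simp [hP.2.1]

theorem IsPath.exists_concat {P : List V} (hP : IsPath G s v P) (hv : v ≠ s) :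
    ∃ u P', IsPath G s u P' ∧ G.Adj u v ∧ P = P' ++ [v] := by
  obtain ⟨hc, hh, hl⟩ := hP
  obtain ⟨P', rfl⟩ := List.getLast?_eq_some_iff.1 hl
  rcases P'.eq_nil_or_concat with rfl | ⟨P'', u, rfl⟩
  · simp at hh
    exact absurd hh hv
  · rw [List.concat_eq_append] at *
    rw [List.isChain_append] at hc
    refine ⟨u, _, ⟨hc.1, ?_, by simp⟩, hc.2.2 u (by simp) v (by simp), rfl⟩
    simpa [List.head?_append] using hh

/-- The optimality equation: a path to `v ≠ s` is a path to some predecessor of `v` followed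
by `v`. -/
theorem minMaxValue_eq_max (hv : v ≠ s) :
    minMaxValue G f s v =
      max (f v : ℕ∞) (⨅ u ∈ {u | G.Adj u v}, minMaxValue G f s u) := by
  apply le_antisymm
  · change _ ≤ (f v : ℕ∞) ⊔ _
    simp only [minMaxValue, sup_iInf₂_eq]
    refine le_iInf₂ fun u hu => le_iInf₂ fun P hP => ?_
    refine (minMaxValue_le_of_isPath (f := f) (IsPath.concat hP hu)).trans (iSup₂_le fun w hw => ?_)
    rcases List.mem_append.1 hw with hw | hw
    · exact (le_iSup₂ (f := fun u (_ : u ∈ P) => (f u : ℕ∞)) w hw).trans le_sup_right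
    · rw [List.mem_singleton.1 hw]
      exact le_sup_left
  · refine max_le le_minMaxValue (le_iInf₂ fun P hP => ?_)
    obtain ⟨u, P', hP', hu, rfl⟩ := IsPath.exists_concat hP hv
    refine (iInf₂_le (f := fun u (_ : u ∈ {u | G.Adj u v}) => minMaxValue G f s u) u hu).trans
      ((minMaxValue_le_of_isPath hP').trans (biSup_mono fun w hw => ?_))
    exact List.mem_append_left _ hw

/-- The infimum in the min-max value is attained where it is finite. -/
theorem minMaxValue_le_natCast_iff {p : ℕ} :
    minMaxValue G f s v ≤ p ↔ ∃ P, IsPath G s v P ∧ ∀ u ∈ P, f u ≤ p := by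
  constructor
  · intro h
    have h' : minMaxValue G f s v < ((p + 1 : ℕ) : ℕ∞) :=
      h.trans_lt (by exact_mod_cast Nat.lt_succ_self p)
    simp only [minMaxValue, iInf_lt_iff] at h'
    obtain ⟨P, hP, hlt⟩ := h'
    refine ⟨P, hP, fun u hu => ?_⟩
    have := (le_iSup₂ (f := fun u (_ : u ∈ P) => (f u : ℕ∞)) u hu).trans_lt hlt
    exact Nat.lt_succ_iff.1 (by exact_mod_cast this)
  · rintro ⟨P, hP, h⟩
    exact (minMaxValue_le_of_isPath hP).trans (iSup₂_le fun u hu => by exact_mod_cast h u hu)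

end MinMax

/-! ### The processing graph -/

variable {k : ℕ} {Q : Fin k → List ℕ}

theorem sum_lt_sum_of_adj {u v : Vertex Q} (h : (processingGraph Q).Adj u v) :
    ∑ j, (u j : ℕ) < ∑ j, (v j : ℕ) := by
  obtain ⟨j, hj, hl⟩ := h
  refine Finset.sum_lt_sum (fun i _ => ?_) ⟨j, Finset.mem_univ _, by omega⟩
  by_cases hi : i = j
  · subst hi
    omega
  · rw [hl i hi]

theorem acyclic_processingGraph (Q : Fin k → List ℕ) : Acyclic (processingGraph Q) := by
  intro v hv
  have key : ∀ u w : Vertex Q, Relation.TransGen (processingGraph Q).Adj u w →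
      ∑ j, (u j : ℕ) < ∑ j, (w j : ℕ) := by
    intro u w h
    induction h with
    | single h => exact sum_lt_sum_of_adj h
    | tail _ h ih => exact ih.trans (sum_lt_sum_of_adj h)
  exact lt_irrefl _ (key v v hv)

theorem length_le_maxLength (Q : Fin k → List ℕ) (j : Fin k) : (Q j).length ≤ maxLength Q :=
  Finset.le_sup (f := fun j => (Q j).length) (Finset.mem_univ j)

theorem card_vertex (Q : Fin k → List ℕ) :
    Fintype.card (Vertex Q) = ∏ j, ((Q j).length + 1) := by
  simp [Vertex, Fintype.card_pi]

theorem card_vertex_le (Q : Fin k → List ℕ) :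
    Fintype.card (Vertex Q) ≤ (maxLength Q + 1) ^ k := by
  rw [card_vertex]
  refine (Finset.prod_le_prod' fun j _ => Nat.succ_le_succ (length_le_maxLength Q j)).trans ?_
  simp

/-- The remaining sequences in the configuration of a vertex. -/
def Vertex.remaining (v : Vertex Q) : Fin k → List ℕ := fun j => (Q j).drop (v j)

/-- The vertex of a configuration: the numbers of removed bins. -/
def removed (Q R : Fin k → List ℕ) : Vertex Q :=
  fun j => ⟨(Q j).length - (R j).length, by omega⟩

theorem remaining_removed {R : Fin k → List ℕ} (h : IsConfiguration Q R) :
    (removed Q R).remaining = R :=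
  funext fun j => (List.suffix_iff_eq_drop.1 (h j)).symm

theorem openPallets_remaining (v : Vertex Q) : openPallets Q v.remaining = cut Q v := by
  ext t
  simp only [openPallets, cut, Finset.mem_filter, Vertex.remaining, List.length_drop]
  have h : ∀ j, (Q j).length - ((Q j).length - (v j : ℕ)) = v j := fun j => by omega
  simp only [h]
  refine and_congr_right fun _ => ⟨?_, ?_⟩
  · rintro ⟨⟨i, hi⟩, j, hj⟩
    exact ⟨j, i, hj, hi⟩
  · rintro ⟨j, i, hj, hi⟩
    exact ⟨⟨i, hi⟩, j, hj⟩

theorem openPallets_eq_cut {R : Fin k → List ℕ} (h : IsConfiguration Q R) :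
    openPallets Q R = cut Q (removed Q R) := by
  rw [← openPallets_remaining, remaining_removed h]

theorem transformationStep_remaining {u v : Vertex Q} (h : (processingGraph Q).Adj u v) :
    TransformationStep u.remaining v.remaining := by
  obtain ⟨j, hj, hl⟩ := h
  refine ⟨j, ⟨(Q j)[(u j : ℕ)]'(by omega), ?_⟩, fun l hlj => ?_⟩
  · simp only [Vertex.remaining, hj]
    exact List.drop_eq_getElem_cons _
  · simp only [Vertex.remaining, hl l hlj]

theorem adj_removed {R R' : Fin k → List ℕ} (hR : IsConfiguration Q R)
    (h : TransformationStep R R') : (processingGraph Q).Adj (removed Q R) (removed Q R') := by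
  obtain ⟨j, ⟨b, hb⟩, hl⟩ := h
  refine ⟨j, ?_, fun l hlj => ?_⟩
  · have h₁ := (hR j).length_le
    have h₂ := congrArg List.length hb
    simp only [List.length_cons] at h₂
    simp only [removed]
    omega
  · simp only [removed, hl l hlj]

theorem canBeProcessed_iff (Q : Fin k → List ℕ) (p : ℕ) :
    CanBeProcessed Q p ↔ val Q (target Q) ≤ (p : ℕ∞) := by
  rw [val, minMaxValue_le_natCast_iff]
  constructor
  · rintro ⟨n, R, ⟨h0, hs, hn, hc⟩, hp⟩
    refine ⟨(List.range (n + 1)).map fun i => removed Q (R i), ⟨?_, ?_, ?_⟩, ?_⟩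
    · rw [List.isChain_iff_getElem]
      intro i hi
      simp only [List.length_map, List.length_range] at hi
      simp only [List.getElem_map, List.getElem_range]
      exact adj_removed (hc i (by omega)) (hs i (by omega))
    · simp only [List.head?_map, List.head?_range, Nat.succ_ne_zero, if_false, Option.map_some, h0]
      congr 1
      funext j
      simp [removed, source]
    · simp only [List.getLast?_map, List.getLast?_range, Nat.succ_ne_zero, if_false,
        Option.map_some, Nat.add_sub_cancel]
      congr 1
      funext j
      ext
      simp [removed, target, hn]
    · intro u hu
      obtain ⟨i, hi, rfl⟩ := List.mem_map.1 hu
      have hi : i ≤ n := Nat.lt_succ_iff.1 (List.mem_range.1 hi)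
      rw [← openPallets_eq_cut (hc i hi)]
      exact hp i hi
  · rintro ⟨P, ⟨hc, hh, hl⟩, hp⟩
    rw [List.isChain_iff_getElem] at hc
    have hne : P ≠ [] := by
      rintro rfl
      simp at hh
    have hpos := List.length_pos_iff.2 hne
    have hget : ∀ i (hi : i < P.length), P.getD i (target Q) = P[i] := fun i hi =>
      List.getD_eq_getElem _ _ hi
    refine ⟨P.length - 1, fun i => (P.getD i (target Q)).remaining,
      ⟨?_, fun i hi => ?_, fun j => ?_, fun i hi j => ?_⟩, fun i hi => ?_⟩
    · have : P[0] = source Q := by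
        rw [List.head?_eq_some_head hne] at hh
        rw [← Option.some.inj hh, List.head_eq_getElem]
      simp only [hget 0 hpos, this]
      funext j
      simp [Vertex.remaining, source]
    · simp only [hget i (by omega), hget (i + 1) (by omega)]
      exact transformationStep_remaining (hc i (by omega))
    · have : P[P.length - 1] = target Q := by
        rw [List.getLast?_eq_some_getLast hne] at hl
        rw [← Option.some.inj hl, List.getLast_eq_getElem]
      simp only [hget (P.length - 1) (by omega), this]
      simp [Vertex.remaining, target]
    · exact List.drop_suffix _ _
    · simp only [openPallets_remaining, hget i (by omega)]
      exact hp _ (List.getElem_mem _)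

/-! ### Mixed-radix numbering of the configurations -/

/-- The length of the `i`-th sequence, and `0` where there is none. -/
def len (Q : Fin k → List ℕ) (i : ℕ) : ℕ := if h : i < k then (Q ⟨i, h⟩).length else 0

@[simp] theorem len_val (Q : Fin k → List ℕ) (j : Fin k) : len Q j = (Q j).length := by
  simp [len]

/-- The place value of the `J`-th digit in the mixed-radix system with the digits
`0, …, |q_j|` at place `j`. -/
def stride (Q : Fin k → List ℕ) (J : ℕ) : ℕ := ∏ i ∈ Finset.range J, (len Q i + 1)

/-- The number of bins in the first `J` sequences. -/
def offset (Q : Fin k → List ℕ) (J : ℕ) : ℕ := ∑ i ∈ Finset.range J, len Q i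

theorem stride_succ (Q : Fin k → List ℕ) (J : ℕ) :
    stride Q (J + 1) = stride Q J * (len Q J + 1) := Finset.prod_range_succ _ _

theorem offset_succ (Q : Fin k → List ℕ) (J : ℕ) :
    offset Q (J + 1) = offset Q J + len Q J := Finset.sum_range_succ _ _

theorem stride_eq_card (Q : Fin k → List ℕ) : stride Q k = Fintype.card (Vertex Q) := by
  rw [stride, Finset.prod_range, card_vertex]
  simp

/-- The number of a configuration in the mixed-radix system. -/
def index (v : Vertex Q) : ℕ := ∑ j, (v j : ℕ) * stride Q j

theorem index_eq (v : Vertex Q) : index v = (finPiFinEquiv v : ℕ) := by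
  rw [finPiFinEquiv_apply, index]
  refine Finset.sum_congr rfl fun j _ => ?_
  rw [stride, Finset.prod_range]
  congr 1
  refine Finset.prod_congr rfl fun i _ => ?_
  rw [← len_val Q (Fin.castLE _ i)]
  rfl

theorem index_injective : Function.Injective (index (Q := Q)) := by
  intro u v h
  rw [index_eq, index_eq] at h
  exact finPiFinEquiv.injective (Fin.ext h)

theorem index_target (Q : Fin k → List ℕ) : index (target Q) + 1 = stride Q k := by
  have : ∀ J, (∑ j ∈ Finset.range J, len Q j * stride Q j) + 1 = stride Q J := by
    intro J
    induction J with
    | zero => simp [stride]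
    | succ J ih =>
      rw [Finset.sum_range_succ, stride_succ, mul_add, ← ih]
      ring
  rw [← this k, index, Finset.sum_range]
  simp [target]

/-- `v` arises from `u` by removing one more bin from the `j`-th sequence. -/
def Removes (j : Fin k) (u v : Vertex Q) : Prop :=
  (v j : ℕ) = (u j : ℕ) + 1 ∧ ∀ l, l ≠ j → v l = u l

theorem Removes.lt_length {j : Fin k} {u v : Vertex Q} (h : Removes j u v) :
    (u j : ℕ) < (Q j).length := by
  have := h.1
  omega

theorem exists_removes_of_lt {j : Fin k} {u : Vertex Q} (h : (u j : ℕ) < (Q j).length) :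
    ∃ v, Removes j u v :=
  ⟨Function.update u j ⟨(u j : ℕ) + 1, by omega⟩, by simp,
    fun l hl => Function.update_of_ne hl _ _⟩

theorem exists_removes_of_pos {j : Fin k} {v : Vertex Q} (h : 0 < (v j : ℕ)) :
    ∃ u, Removes j u v :=
  ⟨Function.update v j ⟨(v j : ℕ) - 1, by omega⟩, by simp; omega,
    fun l hl => (Function.update_of_ne hl _ _).symm⟩

theorem Removes.val_eq {j : Fin k} {u v : Vertex Q} (h : Removes j u v) (l : Fin k) :
    (v l : ℕ) = if l = j then (u j : ℕ) + 1 else (u l : ℕ) := by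
  split_ifs with hl
  · rw [hl, h.1]
  · rw [h.2 l hl]

theorem Removes.sum_eq {j : Fin k} {u v : Vertex Q} (h : Removes j u v) (g : Fin k → ℕ → ℕ)
    {d : ℕ} (hd : g j (u j + 1) = g j (u j) + d) :
    ∑ l, g l (v l) = (∑ l, g l (u l)) + d := by
  rw [← Finset.add_sum_erase _ _ (Finset.mem_univ j), ← Finset.add_sum_erase _ (fun l => g l (u l))
    (Finset.mem_univ j), h.1, hd, Finset.sum_congr rfl fun l hl => ?_]
  · exact add_right_comm _ _ _
  · rw [h.2 l (Finset.ne_of_mem_erase hl)]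

theorem Removes.index_eq {j : Fin k} {u v : Vertex Q} (h : Removes j u v) :
    index v = index u + stride Q j :=
  h.sum_eq (fun l x => x * stride Q l) (add_one_mul _ _)

/-! ### Numbers of removed bins and of open pallets -/

/-- The number of removed bins for the pallet `t`. -/
def removedCount (v : Vertex Q) (t : ℕ) : ℕ := ∑ j, ((Q j).take (v j)).count t

/-- The list of all bins, one sequence after the other. -/
def bins (Q : Fin k → List ℕ) : List ℕ := (List.ofFn Q).flatten

theorem count_bins (Q : Fin k → List ℕ) (t : ℕ) : (bins Q).count t = ∑ j, (Q j).count t := by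
  rw [bins, List.count_flatten, List.map_ofFn, List.sum_ofFn]
  rfl

theorem removedCount_source (Q : Fin k → List ℕ) (t : ℕ) : removedCount (source Q) t = 0 := by
  simp [removedCount, source]

theorem mem_cut_iff {v : Vertex Q} {t : ℕ} :
    t ∈ cut Q v ↔ 0 < removedCount v t ∧ removedCount v t < (bins Q).count t := by
  have hsplit : ∀ j, (Q j).count t = ((Q j).take (v j)).count t + ((Q j).drop (v j)).count t :=
    fun j => by rw [← List.count_append, List.take_append_drop]
  have hsum : (bins Q).count t = removedCount v t + ∑ j, ((Q j).drop (v j)).count t := by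
    rw [count_bins, removedCount, ← Finset.sum_add_distrib]
    exact Finset.sum_congr rfl fun j _ => hsplit j
  rw [hsum, lt_add_iff_pos_right, removedCount, Finset.sum_pos_iff, Finset.sum_pos_iff]
  simp only [Finset.mem_univ, true_and, List.count_pos_iff, cut, Finset.mem_filter, plts,
    Finset.mem_biUnion, List.mem_toFinset]
  constructor
  · rintro ⟨-, i, j, hi, hj⟩
    exact ⟨⟨i, hi⟩, j, hj⟩
  · rintro ⟨⟨i, hi⟩, j, hj⟩
    exact ⟨⟨i, List.mem_of_mem_take hi⟩, i, j, hi, hj⟩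

theorem cut_source (Q : Fin k → List ℕ) : cut Q (source Q) = ∅ := by
  ext t
  simp [mem_cut_iff, removedCount_source]

theorem Removes.removedCount_eq {j : Fin k} {u v : Vertex Q} (h : Removes j u v) (t : ℕ) :
    removedCount v t = removedCount u t + if (Q j).getD (u j) 0 = t then 1 else 0 := by
  refine h.sum_eq (fun l x => ((Q l).take x).count t) ?_
  rw [List.getD_eq_getElem _ _ h.lt_length, List.take_succ_eq_append_getElem h.lt_length,
    List.count_append, List.count_singleton]
  simp

theorem removedCount_le (v : Vertex Q) (t : ℕ) : removedCount v t ≤ (bins Q).count t := by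
  rw [count_bins]
  exact Finset.sum_le_sum fun j _ => (List.take_sublist _ _).count_le t

/-- Removing a bin `b` changes the status of no pallet other than that of `b`. Here `g` is the
number of other open pallets. -/
theorem Removes.exists_card_cut {j : Fin k} {u v : Vertex Q} (h : Removes j u v) {b : ℕ}
    (hb : (Q j).getD (u j) 0 = b) :
    removedCount u b < (bins Q).count b ∧ ∃ g,
      (cut Q u).card = g + (if 0 < removedCount u b then 1 else 0) ∧
      (cut Q v).card = g + (if removedCount u b + 1 < (bins Q).count b then 1 else 0) := by
  have hv : removedCount v b = removedCount u b + 1 := by rw [h.removedCount_eq, hb, if_pos rfl]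
  have hlt : removedCount u b < (bins Q).count b := by
    have := removedCount_le v b
    omega
  have hcard : ∀ s : Finset ℕ, s.card = (s.erase b).card + if b ∈ s then 1 else 0 := by
    intro s
    split_ifs with hs
    · exact (Finset.card_erase_add_one hs).symm
    · rw [Finset.erase_eq_of_notMem hs, add_zero]
  refine ⟨hlt, ((cut Q u).erase b).card, ?_, ?_⟩
  · rw [hcard (cut Q u)]
    simp [mem_cut_iff, hlt]
  · rw [hcard (cut Q v)]
    congr 2
    · ext t
      simp only [Finset.mem_erase, mem_cut_iff]
      refine and_congr_right fun ht => ?_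
      rw [h.removedCount_eq, hb, if_neg (Ne.symm ht), add_zero]
    · simp [mem_cut_iff, hv]

/-! ### The layout of the input -/

theorem length_bins (Q : Fin k → List ℕ) : (bins Q).length = offset Q k := by
  rw [bins, List.length_flatten, List.map_ofFn, List.sum_ofFn, offset, Finset.sum_range]
  simp

theorem sum_take_map_length_ofFn (Q : Fin k → List ℕ) {J : ℕ} (hJ : J ≤ k) :
    (((List.ofFn Q).map List.length).take J).sum = offset Q J := by
  induction J with
  | zero => simp [offset]
  | succ J ih =>
    rw [List.sum_take_succ _ _ (by simpa using hJ), ih (by omega), offset_succ]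
    simp [len, show J < k by omega]

theorem bins_getD (Q : Fin k → List ℕ) (j : Fin k) {i : ℕ} (hi : i < (Q j).length) :
    (bins Q).getD (offset Q j + i) 0 = (Q j).getD i 0 := by
  have h := List.drop_take_succ_flatten_eq_getElem (List.ofFn Q) j (by simp)
  rw [sum_take_map_length_ofFn Q j.2, sum_take_map_length_ofFn Q j.2.le, List.getElem_ofFn] at h
  simp only [Fin.eta] at h
  have hj : offset Q (j : ℕ).succ = offset Q j + (Q j).length := by rw [offset_succ, len_val]
  rw [← h]
  simp only [List.getD_eq_getElem?_getD, List.getElem?_drop, List.getElem?_take, bins]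
  rw [if_pos (by omega)]

theorem encode_getD_length (Q : Fin k → List ℕ) (p : ℕ) {i : ℕ} (hi : i < k) :
    (encode Q p).getD (2 + i) 0 = len Q i := by
  rw [add_comm 2, encode, List.getD_cons_succ, List.getD_cons_succ,
    List.getD_append _ _ _ _ (by simpa using hi)]
  simp [len, hi]

theorem encode_getD_bins (Q : Fin k → List ℕ) (p i : ℕ) :
    (encode Q p).getD (k + 2 + i) 0 = (bins Q).getD i 0 := by
  rw [show k + 2 + i = (k + i) + 1 + 1 by ring, encode, List.getD_cons_succ, List.getD_cons_succ,
    List.getD_append_right _ _ _ _ (by simp)]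
  simp [bins]

/-! ### Single moves between configurations -/

/-- Remove the first remaining bin of the sequence whose number is in variable `2`. -/
def removeBin : Prog :=
  .seq (.assign 9 (.cell 0 (.add (.cell 1 (.var 2)) (.cell 4 (.var 2)))))
  (.seq (.branch (.cell 5 (.var 9)) (.const 1) (.assign 7 (.add (.var 7) (.const 1))) .skip)
  (.seq (.store 5 (.var 9) (.add (.cell 5 (.var 9)) (.const 1)))
  (.seq (.branch (.cell 5 (.var 9)) (.cell 3 (.var 9)) .skip
    (.assign 7 (.sub (.var 7) (.const 1))))
  (.store 4 (.var 2) (.add (.cell 4 (.var 2)) (.const 1))))))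

/-- Put the last removed bin back to the sequence whose number is in variable `2`. -/
def restoreBin : Prog :=
  .seq (.store 4 (.var 2) (.sub (.cell 4 (.var 2)) (.const 1)))
  (.seq (.assign 9 (.cell 0 (.add (.cell 1 (.var 2)) (.cell 4 (.var 2)))))
  (.seq (.branch (.cell 5 (.var 9)) (.cell 3 (.var 9)) .skip
    (.assign 7 (.add (.var 7) (.const 1))))
  (.seq (.store 5 (.var 9) (.sub (.cell 5 (.var 9)) (.const 1)))
  (.branch (.cell 5 (.var 9)) (.const 1) (.assign 7 (.sub (.var 7) (.const 1))) .skip))))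

/-- The tables that depend only on the input: array `1` holds the position of the first bin of each
sequence in the input, array `2` the place values, array `3` the number of bins for each pallet,
and variable `4` the number of configurations. -/
structure Prepared (Q : Fin k → List ℕ) (p : ℕ) (s : Store) : Prop where
  input : ∀ i, s.arr 0 i = (encode Q p).getD i 0
  offset : ∀ j : Fin k, s.arr 1 j = k + 2 + offset Q j
  stride : ∀ j : Fin k, s.arr 2 j = stride Q j
  total : ∀ t, s.arr 3 t = (bins Q).count t
  card : s.var 4 = StackUp.stride Q k

/-- The memory represents the configuration `v`: array `4` holds its coordinates, array `5` the
number of removed bins for each pallet, and variable `7` the number of open pallets. -/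
structure Represents (p : ℕ) (v : Vertex Q) (s : Store) : Prop extends Prepared Q p s where
  digit : ∀ j : Fin k, s.arr 4 j = v j
  count : ∀ t, s.arr 5 t = removedCount v t
  opened : s.var 7 = (cut Q v).card

theorem Prepared.seqs {p : ℕ} {s : Store} (h : Prepared Q p s) : s.arr 0 0 = k := by
  rw [h.input]
  rfl

theorem Prepared.places {p : ℕ} {s : Store} (h : Prepared Q p s) : s.arr 0 1 = p := by
  rw [h.input]
  rfl

theorem Prepared.length {p : ℕ} {s : Store} (h : Prepared Q p s) (j : Fin k) :
    s.arr 0 (2 + j) = (Q j).length := by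
  rw [h.input, encode_getD_length _ _ j.2, len_val]

theorem Prepared.bin {p : ℕ} {s : Store} (h : Prepared Q p s) {j : Fin k} {i : ℕ}
    (hi : i < (Q j).length) : s.arr 0 (s.arr 1 j + i) = (Q j).getD i 0 := by
  rw [h.offset, h.input, add_assoc, encode_getD_bins, bins_getD _ _ hi]

/-- The part of the memory that a move between configurations leaves alone. -/
def Frame (s s' : Store) : Prop :=
  (∀ x, x ≠ 7 → x ≠ 9 → s'.var x = s.var x) ∧ ∀ i, s'.arr 6 i = s.arr 6 i

theorem Frame.refl (s : Store) : Frame s s := ⟨fun _ _ _ => rfl, fun _ => rfl⟩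

theorem Frame.trans {s s' s'' : Store} (h : Frame s s') (h' : Frame s' s'') : Frame s s'' :=
  ⟨fun x h₁ h₂ => (h'.1 x h₁ h₂).trans (h.1 x h₁ h₂), fun i => (h'.2 i).trans (h.2 i)⟩

theorem Represents.of_eq {p : ℕ} {u v : Vertex Q} {s s' : Store} (h : Represents p u s)
    (h₀ : ∀ i, s'.arr 0 i = s.arr 0 i) (h₁ : ∀ i, s'.arr 1 i = s.arr 1 i)
    (h₂ : ∀ i, s'.arr 2 i = s.arr 2 i) (h₃ : ∀ i, s'.arr 3 i = s.arr 3 i)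
    (h₄ : s'.var 4 = s.var 4) (digit : ∀ j : Fin k, s'.arr 4 j = v j)
    (count : ∀ t, s'.arr 5 t = removedCount v t) (opened : s'.var 7 = (cut Q v).card) :
    Represents p v s' where
  input i := (h₀ i).trans (h.input i)
  offset j := (h₁ j).trans (h.offset j)
  stride j := (h₂ j).trans (h.stride j)
  total t := (h₃ t).trans (h.total t)
  card := h₄.trans h.card
  digit := digit
  count := count
  opened := opened

theorem runs_removeBin {p : ℕ} {u v : Vertex Q} {j : Fin k} (huv : Removes j u v) {s : Store}
    (hs : Represents p u s) (hj : s.var 2 = j) :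
    Runs removeBin s fun s' t => Represents p v s' ∧ Frame s s' ∧ t ≤ 50 := by
  obtain ⟨b, hb⟩ : ∃ b, (Q j).getD (u j) 0 = b := ⟨_, rfl⟩
  obtain ⟨hlt, g, hu, hv⟩ := huv.exists_card_cut hb
  have hcount := huv.removedCount_eq
  have hval := huv.val_eq
  have hbin := hs.bin huv.lt_length
  rw [hb] at hbin hcount
  simp only [← hs.count, ← hs.opened, ← hs.total, ← hs.digit] at hlt hu hv hcount hval hbin
  simp only [removeBin, runs_seq, runs_assign, runs_store, runs_branch, runs_skip, Expr.eval,
    Expr.cost, uniformCost, Store.setVar_var, Store.setVar_arr, Store.setArr_var, Store.setArr_arr,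
    hj, hbin, reduceIte, and_self, false_and, Nat.reduceEqDiff]
  refine ⟨fun h₁ => ⟨fun h₂ => ?_, fun h₂ => ?_⟩, fun h₁ => ⟨fun h₂ => ?_, fun h₂ => ?_⟩⟩
  all_goals
    refine ⟨hs.of_eq (by simp) (by simp) (by simp) (by simp) (by simp) ?_ ?_ ?_,
      ⟨fun x hx hx' => by simp [hx, hx'], by simp⟩, by norm_num⟩
    · intro l
      simp [hval, Fin.ext_iff]
    · intro t
      rw [hcount]
      by_cases ht : t = b
      · simp [ht]
      · simp [ht, Ne.symm ht]
    · simp only [Store.setVar_var, Store.setArr_var, reduceIte, Nat.reduceEqDiff]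
      split_ifs at hu hv <;> omega

theorem runs_restoreBin {p : ℕ} {u v : Vertex Q} {j : Fin k} (huv : Removes j u v) {s : Store}
    (hs : Represents p v s) (hj : s.var 2 = j) :
    Runs restoreBin s fun s' t => Represents p u s' ∧ Frame s s' ∧ t ≤ 50 := by
  obtain ⟨b, hb⟩ : ∃ b, (Q j).getD (u j) 0 = b := ⟨_, rfl⟩
  obtain ⟨hlt, g, hu, hv⟩ := huv.exists_card_cut hb
  have hcount := huv.removedCount_eq
  have hval := huv.val_eq
  have hbin := hs.bin huv.lt_length
  have hdig : s.arr 4 j - 1 = u j := by rw [hs.digit, huv.1, Nat.add_sub_cancel]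
  have hb' : s.arr 5 b = removedCount u b + 1 := by rw [hs.count, hcount, hb, if_pos rfl]
  rw [hb] at hbin hcount
  rw [← hb'] at hv
  simp only [← hs.count, ← hs.opened, ← hs.total, ← hs.digit] at hlt hu hv hcount hval
  simp only [restoreBin, runs_seq, runs_assign, runs_store, runs_branch, runs_skip, Expr.eval,
    Expr.cost, uniformCost, Store.setVar_var, Store.setVar_arr, Store.setArr_var, Store.setArr_arr,
    hj, hdig, hbin, reduceIte, and_self, false_and, Nat.reduceEqDiff]
  refine ⟨fun h₁ => ⟨fun h₂ => ?_, fun h₂ => ?_⟩, fun h₁ => ⟨fun h₂ => ?_, fun h₂ => ?_⟩⟩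
  all_goals
    refine ⟨hs.of_eq (by simp) (by simp) (by simp) (by simp) (by simp) ?_ ?_ ?_,
      ⟨fun x hx hx' => by simp [hx, hx'], by simp⟩, by norm_num⟩
    · intro l
      by_cases hl : l = j
      · subst hl
        simp
      · simp [hval, hl, Fin.val_inj]
    · intro t
      by_cases ht : t = b
      · simp [ht, hb']
      · simp [ht, hcount, Ne.symm ht]
    · simp only [Store.setVar_var, Store.setArr_var, reduceIte, Nat.reduceEqDiff]
      split_ifs at hu hv <;> omega

/-! ### Enumeration of the configurations -/

theorem Represents.congr {p : ℕ} {v : Vertex Q} {s s' : Store} (h : Represents p v s)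
    (ha : s'.arr = s.arr) (h₄ : s'.var 4 = s.var 4) (h₇ : s'.var 7 = s.var 7) :
    Represents p v s' :=
  h.of_eq (by simp [ha]) (by simp [ha]) (by simp [ha]) (by simp [ha]) h₄
    (by simpa [ha] using h.digit) (by simpa [ha] using h.count) (h₇.trans h.opened)

/-- Put all removed bins back to the sequence whose number is in variable `2`. -/
def resetDigit : Prog := .loop (.const 0) (.cell 4 (.var 2)) restoreBin

theorem runs_resetDigit {p : ℕ} {v : Vertex Q} {j : Fin k} {s : Store}
    (hs : Represents p v s) (hj : s.var 2 = j) :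
    Runs resetDigit s fun s' t => ∃ u : Vertex Q, Represents p u s' ∧ (u j : ℕ) = 0 ∧
      (∀ l, l ≠ j → u l = v l) ∧ Frame s s' ∧ t ≤ 60 * v j + 4 := by
  refine (runs_loop (fun s' => ∃ u : Vertex Q, Represents p u s' ∧ (∀ l, l ≠ j → u l = v l) ∧
    Frame s s') (fun s' => 60 * s'.arr 4 j) ?_ ⟨v, hs, fun _ _ => rfl, .refl s⟩).mono ?_
  · rintro s₁ ⟨u, hu, hl, hf⟩ hlt
    have hj₁ : s₁.var 2 = j := (hf.1 2 (by norm_num) (by norm_num)).trans hj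
    simp only [Expr.eval, hj₁, hu.digit] at hlt
    obtain ⟨w, hw⟩ := exists_removes_of_pos hlt
    refine (runs_restoreBin hw hu hj₁).mono fun s₂ t ⟨h, hf', ht⟩ => ?_
    refine ⟨⟨w, h, fun l hlj => (hw.2 l hlj).symm.trans (hl l hlj), hf.trans hf'⟩, ?_⟩
    simp only [Expr.cost, uniformCost]
    rw [h.digit, hu.digit, hw.1]
    omega
  · rintro s₁ t ⟨⟨u, hu, hl, hf⟩, hn, ht⟩
    have hj₁ : s₁.var 2 = j := (hf.1 2 (by norm_num) (by norm_num)).trans hj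
    simp only [Expr.eval, hj₁, hu.digit] at hn
    simp only [Expr.cost, uniformCost, hs.digit] at ht
    exact ⟨u, hu, by omega, hl, hf, by omega⟩

/-- One step of the addition of `1` in the mixed-radix system, at the place in variable `2`. The
carry is in variable `5`. -/
def carryStep : Prog :=
  .seq
    (.branch (.const 0) (.var 5)
      (.branch (.cell 4 (.var 2)) (.cell 0 (.add (.const 2) (.var 2)))
        (.seq removeBin (.assign 5 (.const 0))) resetDigit)
      .skip)
    (.assign 2 (.add (.var 2) (.const 1)))

/-- Move to the configuration with the next number, and increase the number in variable `6`. -/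
def advance : Prog :=
  .seq (.assign 2 (.const 0)) (.seq (.assign 5 (.const 1))
    (.seq (.loop (.var 2) (.cell 0 (.const 0)) carryStep)
      (.assign 6 (.add (.var 6) (.const 1)))))

/-- The sum of the coordinates of the represented configuration. It is the potential that pays for
the resets of digits, so that counting up takes constant amortized time per place. -/
def digitSum (k : ℕ) (s : Store) : ℕ := ∑ j : Fin k, s.arr 4 j

theorem Represents.digitSum_eq {p : ℕ} {v : Vertex Q} {s : Store} (h : Represents p v s) :
    digitSum k s = ∑ j, (v j : ℕ) :=
  Finset.sum_congr rfl fun j _ => h.digit j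

theorem sum_eq_add_of_reset {u v : Vertex Q} {j : Fin k} (h₀ : (u j : ℕ) = 0)
    (h : ∀ l, l ≠ j → u l = v l) (c : Fin k → ℕ) :
    ∑ l, (v l : ℕ) * c l = (∑ l, (u l : ℕ) * c l) + v j * c j := by
  rw [← Finset.add_sum_erase _ _ (Finset.mem_univ j),
    ← Finset.add_sum_erase _ (fun l => (u l : ℕ) * c l) (Finset.mem_univ j), h₀, zero_mul, zero_add,
    add_comm, Finset.sum_congr rfl fun l hl => ?_]
  rw [h l (Finset.ne_of_mem_erase hl)]

theorem runs_carryStep {p x : ℕ} {v : Vertex Q} {j : Fin k} {s : Store} (hs : Represents p v s)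
    (hj : s.var 2 = j) (hx : x = index v + if 0 < s.var 5 then stride Q j else 0) :
    Runs carryStep s fun s' t => ∃ w : Vertex Q, Represents p w s' ∧ s'.var 2 = j + 1 ∧
      (x = index w + if 0 < s'.var 5 then stride Q (j + 1) else 0) ∧ s'.var 6 = s.var 6 ∧
      (∀ i, s'.arr 6 i = s.arr 6 i) ∧ t + 60 * digitSum k s' ≤ 60 * digitSum k s + 150 := by
  rw [carryStep, runs_seq, runs_branch, runs_branch]
  simp only [Expr.eval, hj, hs.digit, hs.length, runs_seq, runs_assign, Expr.cost, uniformCost]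
  refine ⟨fun hc => ⟨fun hlt => ?_, fun hle => ?_⟩, fun hc => ?_⟩
  · rw [if_pos hc] at hx
    obtain ⟨w, hw⟩ := exists_removes_of_lt hlt
    refine (runs_removeBin hw hs hj).mono fun s₁ t ⟨h, hf, ht⟩ => ?_
    have h2 := hf.1 2 (by norm_num) (by norm_num)
    have h6 := hf.1 6 (by norm_num) (by norm_num)
    have h' : Represents p w ((s₁.setVar 5 0).setVar 2 (s₁.var 2 + 1)) :=
      h.congr rfl (by simp) (by simp)
    have hsum := hw.sum_eq (fun _ y => y) (d := 1) rfl
    have hidx := hw.index_eq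
    refine ⟨w, by simpa using h', by simp [h2, hj], by simp [hx, hidx], by simp [h6],
      by simpa using hf.2, ?_⟩
    simp only [Store.setVar_var, Nat.reduceEqDiff, reduceIte]
    rw [h'.digitSum_eq, hs.digitSum_eq, hsum]
    omega
  · rw [if_pos hc] at hx
    refine (runs_resetDigit hs hj).mono fun s₁ t ⟨w, h, h0, hl, hf, ht⟩ => ?_
    have h2 := hf.1 2 (by norm_num) (by norm_num)
    have h5 := hf.1 5 (by norm_num) (by norm_num)
    have h6 := hf.1 6 (by norm_num) (by norm_num)
    have h' : Represents p w (s₁.setVar 2 (s₁.var 2 + 1)) := h.congr rfl (by simp) (by simp)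
    have hsum := sum_eq_add_of_reset h0 hl fun _ => 1
    simp only [mul_one] at hsum
    have hidx : index v = index w + v j * stride Q j :=
      sum_eq_add_of_reset h0 hl fun l => stride Q l
    -- The digit is the largest one at its place, so that the carry moves to the next place.
    have hv : (v j : ℕ) = (Q j).length := by omega
    refine ⟨w, h', by simp [h2, hj], ?_, by simp [h6], by simpa using hf.2, ?_⟩
    · simp only [Store.setVar_var, Nat.reduceEqDiff, reduceIte, h5, hc]
      rw [hx, hidx, stride_succ, len_val, hv]
      ring
    · rw [h'.digitSum_eq, hs.digitSum_eq, hsum]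
      omega
  · rw [if_neg hc] at hx
    rw [runs_skip]
    refine ⟨v, hs.congr rfl (by simp) (by simp), by simp [hj], by simp [hx, hc], by simp,
      by simp, ?_⟩
    simp only [digitSum, Store.setVar_arr]
    omega

theorem runs_advance {p : ℕ} {v : Vertex Q} {s : Store} (hs : Represents p v s)
    (h6 : s.var 6 = index v) :
    Runs advance s fun s' t => ∃ w : Vertex Q, Represents p w s' ∧ s'.var 6 = s.var 6 + 1 ∧
      (s'.var 6 < stride Q k → s'.var 6 = index w) ∧ (∀ i, s'.arr 6 i = s.arr 6 i) ∧
      t + 60 * digitSum k s' ≤ 60 * digitSum k s + 160 * k + 20 := by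
  simp only [advance, runs_seq, runs_assign, Expr.eval, Expr.cost, uniformCost]
  refine (runs_loop (fun s' => ∃ w : Vertex Q, Represents p w s' ∧ s'.var 2 ≤ k ∧
    (s.var 6 + 1 = index w + if 0 < s'.var 5 then stride Q (s'.var 2) else 0) ∧
    s'.var 6 = s.var 6 ∧ ∀ i, s'.arr 6 i = s.arr 6 i)
    (fun s' => 60 * digitSum k s' + 160 * (k - s'.var 2)) ?_ ?_).mono ?_
  · rintro s₁ ⟨w, hw, -, hx, h6', ha⟩ hlt
    simp only [Expr.eval, hw.seqs] at hlt
    obtain ⟨j, hj⟩ : ∃ j : Fin k, s₁.var 2 = j := ⟨⟨_, hlt⟩, rfl⟩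
    rw [hj] at hx
    refine (runs_carryStep hw hj hx).mono fun s₂ t ⟨w', hw', h2, hx', h6'', ha', ht⟩ => ?_
    refine ⟨⟨w', hw', by omega, by rw [h2]; exact hx', h6''.trans h6',
      fun i => (ha' i).trans (ha i)⟩, ?_⟩
    simp only [Expr.cost, uniformCost, h2, hj]
    omega
  · exact ⟨v, hs.congr rfl (by simp) (by simp), by simp, by simp [h6, stride], by simp, by simp⟩
  · rintro s₁ t ⟨⟨w, hw, hle, hx, h6', ha⟩, hn, ht⟩
    simp only [Expr.eval, hw.seqs] at hn
    rw [show s₁.var 2 = k by omega] at hx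
    refine ⟨w, hw.congr rfl (by simp) (by simp), by simp [h6'], ?_, by simpa using ha, ?_⟩
    · simp only [Store.setVar_var, reduceIte, h6']
      -- A carry out of the last place only occurs at the last configuration.
      intro hlt
      split_ifs at hx <;> omega
    · simp only [Expr.cost, uniformCost, digitSum, Store.setVar_arr, Store.setVar_var, reduceIte]
        at ht ⊢
      omega

/-! ### Values of the configurations -/

/-- `m` encodes the minimum of the values of those predecessors of `v` that have one bin more in one
of the first `J` sequences: `0` stands for no predecessor, and `x + 1` for the minimum `x`. -/
structure IsBest (v : Vertex Q) (J m : ℕ) : Prop where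
  le_val : ∀ j : Fin k, j < J → ∀ u, Removes j u v → m ≠ 0 ∧ ((m - 1 : ℕ) : ℕ∞) ≤ val Q u
  attained : m ≠ 0 → ∃ u, (processingGraph Q).Adj u v ∧ ((m - 1 : ℕ) : ℕ∞) = val Q u

theorem isBest_zero (v : Vertex Q) : IsBest v 0 0 := ⟨by simp, by simp⟩

theorem IsBest.succ_of_eq_zero {v : Vertex Q} {j : Fin k} {m : ℕ} (h : IsBest v j m)
    (hj : (v j : ℕ) = 0) : IsBest v (j + 1) m := by
  refine ⟨fun l hl u hu => ?_, h.attained⟩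
  rcases Nat.lt_succ_iff_lt_or_eq.1 hl with hl | hl
  · exact h.le_val l hl u hu
  · obtain rfl := Fin.ext hl
    have := hu.1
    omega

theorem Removes.left_unique {j : Fin k} {u u' v : Vertex Q} (h : Removes j u v)
    (h' : Removes j u' v) : u = u' := by
  funext l
  by_cases hl : l = j
  · subst hl
    have := h.1
    have := h'.1
    omega
  · exact (h.2 l hl).symm.trans (h'.2 l hl)

theorem IsBest.succ_of_removes {u v : Vertex Q} {j : Fin k} {m n : ℕ} (h : IsBest v j m)
    (hu : Removes j u v) (hn : (n : ℕ∞) = val Q u) :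
    IsBest v (j + 1) (if m < 1 then n + 1 else if n + 1 < m then n + 1 else m) := by
  have hlast : ∀ {l : Fin k} {w : Vertex Q}, (l : ℕ) < j + 1 → Removes l w v →
      (l : ℕ) < j ∨ w = u := by
    intro l w hl hw
    rcases Nat.lt_succ_iff_lt_or_eq.1 hl with hl | hl
    · exact .inl hl
    · obtain rfl := Fin.ext hl
      exact .inr (hw.left_unique hu)
  split_ifs with h₁ h₂
  · refine ⟨fun l hl w hw => ⟨by omega, ?_⟩, fun _ => ⟨u, ⟨j, hu⟩, by simpa using hn⟩⟩
    rcases hlast hl hw with hl | rfl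
    · exact absurd h₁ (by have := (h.le_val l hl w hw).1; omega)
    · simp [hn]
  · refine ⟨fun l hl w hw => ⟨by omega, ?_⟩, fun _ => ⟨u, ⟨j, hu⟩, by simpa using hn⟩⟩
    rcases hlast hl hw with hl | rfl
    · refine le_trans ?_ (h.le_val l hl w hw).2
      exact_mod_cast (show n + 1 - 1 ≤ m - 1 by omega)
    · simp [hn]
  · refine ⟨fun l hl w hw => ⟨by omega, ?_⟩, h.attained⟩
    rcases hlast hl hw with hl | rfl
    · exact (h.le_val l hl w hw).2
    · rw [← hn]
      exact_mod_cast (show m - 1 ≤ n by omega)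

/-- The value of a configuration from the best value of its predecessors. At the initial
configuration, the truncated difference `0 - 1` has the effect of ignoring the predecessors. -/
theorem IsBest.val_eq {v : Vertex Q} {m : ℕ} (h : IsBest v k m) :
    val Q v = ((max (cut Q v).card (m - 1) : ℕ) : ℕ∞) := by
  by_cases hv : v = source Q
  · have hm : m = 0 := by
      by_contra hm
      obtain ⟨u, ⟨j, hj, -⟩, -⟩ := h.attained hm
      simp [hv, source] at hj
    rw [hm, hv, val, minMaxValue_self]
    simp
  · rw [val, minMaxValue_eq_max hv, (Nat.mono_cast (α := ℕ∞)).map_max]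
    congr 1
    obtain ⟨j, hj⟩ : ∃ j, v j ≠ 0 := by
      by_contra hc
      push Not at hc
      exact hv (funext hc)
    obtain ⟨u, hu⟩ := exists_removes_of_pos (Nat.pos_of_ne_zero fun h0 => hj (Fin.ext h0))
    obtain ⟨w, hw, hval⟩ := h.attained (h.le_val j j.2 u hu).1
    apply le_antisymm
    · rw [hval]
      exact iInf₂_le (f := fun u (_ : u ∈ {u | (processingGraph Q).Adj u v}) => val Q u) w hw
    · refine le_iInf₂ fun w hw => ?_
      obtain ⟨l, hl⟩ := hw
      exact (h.le_val l l.2 w hl).2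

/-- Array `6` holds the values of all configurations with a number below `x`. -/
def Known (Q : Fin k → List ℕ) (x : ℕ) (s : Store) : Prop :=
  ∀ u : Vertex Q, index u < x → (s.arr 6 (index u) : ℕ∞) = val Q u

/-- One step of the minimization over the predecessors of the represented configuration, for the
sequence whose number is in variable `2`. The minimum is in variable `8`, in the encoding of
`IsBest`. -/
def minStep : Prog :=
  .seq
    (.branch (.const 0) (.cell 4 (.var 2))
      (.seq (.assign 9 (.add (.cell 6 (.sub (.var 6) (.cell 2 (.var 2)))) (.const 1)))
        (.branch (.var 8) (.const 1) (.assign 8 (.var 9))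
          (.branch (.var 9) (.var 8) (.assign 8 (.var 9)) .skip)))
      .skip)
    (.assign 2 (.add (.var 2) (.const 1)))

/-- Store the value of the represented configuration, whose number is in variable `6`. -/
def evaluate : Prog :=
  .seq (.assign 2 (.const 0)) (.seq (.assign 8 (.const 0))
    (.seq (.loop (.var 2) (.cell 0 (.const 0)) minStep)
      (.branch (.add (.var 7) (.const 1)) (.var 8)
        (.store 6 (.var 6) (.sub (.var 8) (.const 1)))
        (.store 6 (.var 6) (.var 7)))))

theorem runs_minStep {p : ℕ} {v : Vertex Q} {j : Fin k} {s : Store} (hs : Represents p v s)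
    (h6 : s.var 6 = index v) (hk : Known Q (index v) s) (hj : s.var 2 = j)
    (hb : IsBest v j (s.var 8)) :
    Runs minStep s fun s' t => s'.var 2 = j + 1 ∧ IsBest v (j + 1) (s'.var 8) ∧
      s'.arr = s.arr ∧ (∀ x, x ≠ 2 → x ≠ 8 → x ≠ 9 → s'.var x = s.var x) ∧ t ≤ 50 := by
  simp only [minStep, runs_seq, runs_assign, runs_branch, runs_skip, Expr.eval, Expr.cost,
    uniformCost, hj, hs.digit, Store.setVar_var, Store.setVar_arr, reduceIte, Nat.reduceEqDiff]
  constructor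
  · intro hpos
    obtain ⟨u, hu⟩ := exists_removes_of_pos hpos
    have hidx : index v - stride Q j = index u := by rw [hu.index_eq, Nat.add_sub_cancel]
    have hlt : index u < index v := by
      have : 0 < stride Q j := Finset.prod_pos fun i _ => Nat.succ_pos _
      rw [hu.index_eq]
      omega
    have hb' := hb.succ_of_removes hu (hk u hlt)
    simp only [h6, hs.stride, hidx]
    refine ⟨fun h₁ => ?_, fun h₁ => ⟨fun h₂ => ?_, fun h₂ => ?_⟩⟩
    · rw [if_pos h₁] at hb'
      exact ⟨trivial, hb', trivial, fun x h h' h'' => by simp [h, h', h''], by norm_num⟩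
    · rw [if_neg h₁, if_pos h₂] at hb'
      exact ⟨trivial, hb', trivial, fun x h h' h'' => by simp [h, h', h''], by norm_num⟩
    · rw [if_neg h₁, if_neg h₂] at hb'
      exact ⟨trivial, hb', trivial, fun x h h' h'' => by simp [h, h''], by norm_num⟩
  · intro h0
    exact ⟨trivial, hb.succ_of_eq_zero (by omega), trivial, fun x h _ _ => by simp [h], by norm_num⟩

theorem runs_evaluate {p : ℕ} {v : Vertex Q} {s : Store} (hs : Represents p v s)
    (h6 : s.var 6 = index v) (hk : Known Q (index v) s) :
    Runs evaluate s fun s' t => Represents p v s' ∧ s'.var 6 = s.var 6 ∧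
      Known Q (index v + 1) s' ∧ t ≤ 60 * k + 30 := by
  simp only [evaluate, runs_seq, runs_assign, Expr.eval, Expr.cost, uniformCost]
  refine (runs_loop (fun s' => IsBest v (s'.var 2) (s'.var 8) ∧ s'.var 2 ≤ k ∧ s'.arr = s.arr ∧
    ∀ x, x ≠ 2 → x ≠ 8 → x ≠ 9 → s'.var x = s.var x)
    (fun s' => 60 * (k - s'.var 2)) ?_ ?_).mono ?_
  · rintro s₁ ⟨hb, -, ha, hx⟩ hlt
    have h₁ : Represents p v s₁ := hs.congr ha (hx 4 (by norm_num) (by norm_num) (by norm_num))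
      (hx 7 (by norm_num) (by norm_num) (by norm_num))
    simp only [Expr.eval, h₁.seqs] at hlt
    obtain ⟨j, hj⟩ : ∃ j : Fin k, s₁.var 2 = j := ⟨⟨_, hlt⟩, rfl⟩
    rw [hj] at hb
    have hk₁ : Known Q (index v) s₁ := by
      intro u hu
      rw [ha]
      exact hk u hu
    refine (runs_minStep h₁ ((hx 6 (by norm_num) (by norm_num) (by norm_num)).trans h6) hk₁ hj
      hb).mono fun s₂ t ⟨h2, hb', ha', hx', ht⟩ => ?_
    refine ⟨⟨by rw [h2]; exact hb', by omega, ha'.trans ha,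
      fun x h h' h'' => (hx' x h h' h'').trans (hx x h h' h'')⟩, ?_⟩
    simp only [Expr.cost, uniformCost, h2, hj]
    omega
  · exact ⟨by simpa using isBest_zero v, by simp, rfl, fun x h h' _ => by simp [h, h']⟩
  · rintro s₁ t ⟨⟨hb, hle, ha, hx⟩, hn, ht⟩
    have h7 := hx 7 (by norm_num) (by norm_num) (by norm_num)
    have h₁ : Represents p v s₁ := hs.congr ha (hx 4 (by norm_num) (by norm_num) (by norm_num)) h7
    have h6₁ := (hx 6 (by norm_num) (by norm_num) (by norm_num))
    simp only [Expr.eval, h₁.seqs] at hn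
    rw [show s₁.var 2 = k by omega] at hb
    have hval := hb.val_eq
    rw [← h₁.opened] at hval
    simp only [Expr.cost, uniformCost, Store.setVar_var, reduceIte] at ht
    simp only [runs_branch, runs_store, Expr.eval, Expr.cost, uniformCost]
    have hknown : ∀ n : ℕ, (n : ℕ∞) = val Q v →
        Known Q (index v + 1) (s₁.setArr 6 (s₁.var 6) n) := by
      intro n hn u hu
      simp only [Store.setArr_arr, true_and, h6₁, h6]
      split_ifs with he
      · rw [hn, index_injective he]
      · rw [ha]
        exact hk u (by omega)
    have hrep : ∀ n, Represents p v (s₁.setArr 6 (s₁.var 6) n) := fun n =>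
      h₁.of_eq (by simp) (by simp) (by simp) (by simp) rfl (by simpa using h₁.digit)
        (by simpa using h₁.count) h₁.opened
    constructor
    · intro hlt
      refine ⟨hrep _, h6₁, hknown _ ?_, by omega⟩
      rw [hval, max_eq_right (by omega)]
    · intro hge
      refine ⟨hrep _, h6₁, hknown _ ?_, by omega⟩
      rw [hval, max_eq_left (by omega)]

/-! ### Tables for the input -/

/-- Enter the bin at the position in variable `3` into the tables. -/
def scanBin : Prog :=
  .seq (.store 3 (.cell 0 (.var 3)) (.add (.cell 3 (.cell 0 (.var 3))) (.const 1)))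
  (.seq (.assign 3 (.add (.var 3) (.const 1)))
  (.seq (.assign 4 (.add (.var 4) (.cell 2 (.var 2))))
  (.assign 5 (.add (.var 5) (.const 1)))))

/-- Enter the sequence whose number is in variable `2` into the tables. The place value of the next
sequence is computed by repeated addition, once per bin. -/
def scanSequence : Prog :=
  .seq (.store 1 (.var 2) (.var 3))
  (.seq (.store 2 (.var 2) (.var 4))
  (.seq (.assign 5 (.const 0))
  (.seq (.loop (.var 5) (.cell 0 (.add (.const 2) (.var 2))) scanBin)
  (.assign 2 (.add (.var 2) (.const 1))))))

/-- Compute the tables described in `Prepared`. -/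
def prepare : Prog :=
  .seq (.assign 3 (.add (.cell 0 (.const 0)) (.const 2)))
  (.seq (.assign 4 (.const 1))
  (.loop (.var 2) (.cell 0 (.const 0)) scanSequence))

/-- The state of the tables after `J` complete sequences and the first `i` bins of the next one,
with the positions and place values of `n` sequences known. Variable `3` is the position of the next
bin in the input, and variable `4` accumulates the place value of the next sequence. -/
structure Scanned (Q : Fin k → List ℕ) (p n J i : ℕ) (s : Store) : Prop where
  input : ∀ l, s.arr 0 l = (encode Q p).getD l 0
  offset : ∀ l < n, s.arr 1 l = k + 2 + offset Q l
  stride : ∀ l < n, s.arr 2 l = stride Q l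
  total : ∀ t, s.arr 3 t = ((bins Q).take (StackUp.offset Q J + i)).count t
  digit : ∀ l, s.arr 4 l = 0
  count : ∀ l, s.arr 5 l = 0
  seq : s.var 2 = J
  pos : s.var 3 = k + 2 + (StackUp.offset Q J + i)
  card : s.var 4 = StackUp.stride Q J * (i + 1)
  index : s.var 6 = 0
  opened : s.var 7 = 0

theorem offset_mono (Q : Fin k → List ℕ) : Monotone (offset Q) := fun _ _ h =>
  Finset.sum_le_sum_of_subset (Finset.range_subset_range.2 h)

theorem runs_scanBin {p J i : ℕ} {s : Store} (hs : Scanned Q p (J + 1) J i s) (hJ : J < k)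
    (hi : i < len Q J) :
    Runs scanBin s fun s' t => Scanned Q p (J + 1) J (i + 1) s' ∧ s'.var 5 = s.var 5 + 1 ∧
      t ≤ 50 := by
  have hlt : offset Q J + i < (bins Q).length := by
    have := offset_mono Q (show J + 1 ≤ k from hJ)
    rw [offset_succ] at this
    rw [length_bins]
    omega
  simp only [scanBin, runs_seq, runs_assign, runs_store, Expr.eval, Expr.cost, uniformCost,
    Store.setVar_var, Store.setVar_arr, Store.setArr_var, Store.setArr_arr, reduceIte,
    Nat.reduceEqDiff, false_and]
  refine ⟨⟨by simpa using hs.input, by simpa using hs.offset, by simpa using hs.stride, fun t => ?_,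
    by simpa using hs.digit, by simpa using hs.count, by simpa using hs.seq, ?_, ?_,
    by simpa using hs.index, by simpa using hs.opened⟩, trivial, by norm_num⟩
  · have hb : s.arr 0 (s.var 3) = (bins Q)[offset Q J + i] := by
      rw [hs.pos, hs.input, encode_getD_bins, List.getD_eq_getElem _ _ hlt]
    rw [← add_assoc, List.take_succ_eq_append_getElem hlt, List.count_append, ← hb, ← hs.total,
      List.count_singleton]
    by_cases ht : t = s.arr 0 (s.var 3)
    · simp [ht]
    · simp [ht, Ne.symm ht]
  · simp [hs.pos, add_assoc]
  · simp only [Store.setVar_var, Nat.reduceEqDiff, reduceIte, hs.card, hs.seq,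
      hs.stride J (Nat.lt_succ_self J)]
    ring

theorem runs_scanSequence {p J : ℕ} {s : Store} (hs : Scanned Q p J J 0 s) (hJ : J < k) :
    Runs scanSequence s fun s' t => Scanned Q p (J + 1) (J + 1) 0 s' ∧
      t ≤ 60 * len Q J + 30 := by
  simp only [scanSequence, runs_seq, runs_assign, runs_store, Expr.eval, Expr.cost, uniformCost]
  refine (runs_loop (fun s' => s'.var 5 ≤ len Q J ∧ Scanned Q p (J + 1) J (s'.var 5) s')
    (fun s' => 60 * (len Q J - s'.var 5)) ?_ ?_).mono ?_
  · rintro s₁ ⟨-, h₁⟩ hlt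
    simp only [Expr.eval, h₁.seq, h₁.input, encode_getD_length Q p hJ] at hlt
    refine (runs_scanBin h₁ hJ hlt).mono fun s₂ t ⟨h₂, h5, ht⟩ => ?_
    rw [← h5] at h₂
    refine ⟨⟨by omega, h₂⟩, ?_⟩
    simp only [Expr.cost, uniformCost]
    omega
  · refine ⟨by simp, ?_⟩
    have hle : ∀ {l}, l < J + 1 → l = J ∨ l ≠ J ∧ l < J := by omega
    refine ⟨by simpa using hs.input, fun l hl => ?_, fun l hl => ?_, by simpa using hs.total,
      by simpa using hs.digit, by simpa using hs.count, by simpa using hs.seq,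
      by simpa using hs.pos, by simpa using hs.card, by simpa using hs.index,
      by simpa using hs.opened⟩
    · rcases hle hl with rfl | ⟨hne, hl⟩
      · simp [hs.seq, hs.pos]
      · simp [hs.seq, hne, hs.offset l hl]
    · rcases hle hl with rfl | ⟨hne, hl⟩
      · simp [hs.seq, hs.card]
      · simp [hs.seq, hne, hs.stride l hl]
  · rintro s₁ t ⟨⟨hle, h₁⟩, hn, ht⟩
    simp only [Expr.eval, h₁.seq, h₁.input, encode_getD_length Q p hJ] at hn
    have h5 : s₁.var 5 = len Q J := by omega
    rw [h5] at h₁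
    simp only [Expr.cost, uniformCost, Store.setVar_var, reduceIte] at ht ⊢
    refine ⟨⟨by simpa using h₁.input, by simpa using h₁.offset, by simpa using h₁.stride, ?_,
      by simpa using h₁.digit, by simpa using h₁.count, by simp [h₁.seq], ?_, ?_,
      by simpa using h₁.index, by simpa using h₁.opened⟩, by omega⟩
    · simpa [offset_succ] using h₁.total
    · simpa [offset_succ] using h₁.pos
    · simpa [stride_succ] using h₁.card

theorem scanned_init (Q : Fin k → List ℕ) (p : ℕ) :
    Scanned Q p 0 0 0 (((Store.init (encode Q p)).setVar 3 (k + 2)).setVar 4 1) := by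
  constructor <;> simp [Store.init, offset, stride]

theorem Scanned.represents {p : ℕ} {s : Store} (h : Scanned Q p k k 0 s) :
    Represents p (source Q) s where
  input := h.input
  offset j := h.offset j j.2
  stride j := h.stride j j.2
  total t := by rw [h.total, add_zero, ← length_bins, List.take_length]
  card := by simpa using h.card
  digit j := h.digit j
  count t := by rw [h.count, removedCount_source]
  opened := by rw [h.opened, cut_source, Finset.card_empty]

theorem runs_prepare (Q : Fin k → List ℕ) (p : ℕ) :
    Runs prepare (Store.init (encode Q p)) fun s t => Represents p (source Q) s ∧ s.var 6 = 0 ∧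
      digitSum k s = 0 ∧ t ≤ 60 * offset Q k + 40 * k + 20 := by
  have h0 : (Store.init (encode Q p)).arr 0 0 = k := rfl
  simp only [prepare, runs_seq, runs_assign, Expr.eval, Expr.cost, uniformCost, h0]
  refine (runs_loop (fun s => s.var 2 ≤ k ∧ Scanned Q p (s.var 2) (s.var 2) 0 s)
    (fun s => 60 * (offset Q k - offset Q (s.var 2)) + 40 * (k - s.var 2)) ?_ ?_).mono ?_
  · rintro s ⟨-, hs⟩ hlt
    have hk : s.arr 0 0 = k := by
      rw [hs.input]
      rfl
    simp only [Expr.eval, hk] at hlt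
    refine (runs_scanSequence hs hlt).mono fun s' t ⟨h, ht⟩ => ?_
    have h2 := h.seq
    rw [← h2] at h
    refine ⟨⟨by omega, h⟩, ?_⟩
    have := offset_mono Q (show s.var 2 + 1 ≤ k from hlt)
    simp only [Expr.cost, uniformCost, h2]
    rw [offset_succ] at *
    omega
  · exact ⟨by simp [Store.init], scanned_init Q p⟩
  · rintro s t ⟨⟨hle, hs⟩, hn, ht⟩
    have hk : s.arr 0 0 = k := by
      rw [hs.input]
      rfl
    simp only [Expr.eval, hk] at hn
    have h2 : s.var 2 = k := by omega
    rw [h2] at hs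
    refine ⟨hs.represents, hs.index, by simp [digitSum, hs.digit], ?_⟩
    have hinit : (((Store.init (encode Q p)).setVar 3 (k + 2)).setVar 4 1).var 2 = 0 := rfl
    simp only [Expr.cost, uniformCost, hinit] at ht
    omega

/-! ### The complete program -/

/-- The program that computes the value of the final configuration and compares it with the number
of stack-up places. -/
def solve : Prog :=
  .seq prepare
  (.seq (.loop (.var 6) (.var 4) (.seq evaluate advance))
  (.seq (.assign 1 (.cell 6 (.sub (.var 4) (.const 1))))
  (.branch (.cell 0 (.const 1)) (.var 1) (.assign 0 (.const 0)) (.assign 0 (.const 1)))))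

theorem answers_of_known {p : ℕ} {s : Store}
    (h1 : (s.var 1 : ℕ∞) = val Q (target Q)) (h0 : s.var 0 = if p < s.var 1 then 0 else 1) :
    Answers Q p s := by
  have hiff : CanBeProcessed Q p ↔ ¬ p < s.var 1 := by
    rw [canBeProcessed_iff, ← h1, Nat.cast_le, not_lt]
  refine ⟨fun h => ?_, fun h => ?_, h1⟩
  · rw [h0, if_neg (hiff.1 h)]
  · rw [h0, if_pos (not_not.1 (mt hiff.2 h))]

theorem runs_solve (Q : Fin k → List ℕ) (p : ℕ) :
    Runs solve (Store.init (encode Q p)) fun s t => Answers Q p s ∧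
      t ≤ (220 * k + 60) * stride Q k + 60 * offset Q k + 40 * k + 40 := by
  rw [solve, runs_seq]
  refine (runs_prepare Q p).mono fun s₀ t₀ ⟨h₀, h6, hd, ht₀⟩ => ?_
  rw [runs_seq]
  -- After the last configuration the digits overflow, and variable `6` is no longer the number of
  -- the represented configuration.
  refine (runs_loop (fun s => ∃ v : Vertex Q, Represents p v s ∧
    (s.var 6 < stride Q k → s.var 6 = index v) ∧ Known Q (s.var 6) s)
    (fun s => (220 * k + 60) * (stride Q k - s.var 6) + 60 * digitSum k s) ?_ ?_).mono ?_
  · rintro s ⟨v, hv, hidx, hk⟩ hlt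
    simp only [Expr.eval, hv.card] at hlt
    have hidx := hidx hlt
    rw [runs_seq]
    rw [hidx] at hk
    refine (runs_evaluate hv hidx hk).mono fun s₁ t₁ ⟨h₁, h6₁, hk₁, ht₁⟩ => ?_
    refine (runs_advance h₁ (h6₁.trans hidx)).mono fun s₂ t₂ ⟨w, hw, h6₂, hidx₂, ha, ht₂⟩ => ?_
    refine ⟨⟨w, hw, hidx₂, fun u hu => ?_⟩, ?_⟩
    · rw [ha]
      exact hk₁ u (by omega)
    · have hsum : digitSum k s₁ = digitSum k s := by rw [h₁.digitSum_eq, hv.digitSum_eq]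
      have hsub : stride Q k - s.var 6 = stride Q k - s₂.var 6 + 1 := by omega
      simp only [Expr.cost, uniformCost]
      rw [hsub, mul_add_one]
      omega
  · exact ⟨source Q, h₀, fun _ => by simp [h6, index, source], fun u hu => by omega⟩
  · rintro s t ⟨⟨v, hv, hidx, hk⟩, hn, ht⟩
    simp only [Expr.eval, hv.card] at hn
    simp only [Expr.cost, uniformCost, h6, hd, Nat.sub_zero, mul_zero, add_zero] at ht
    have htgt := index_target Q
    have hval : (s.arr 6 (stride Q k - 1) : ℕ∞) = val Q (target Q) := by
      rw [← hk (target Q) (by omega), ← htgt, Nat.add_sub_cancel]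
    simp only [runs_seq, runs_assign, runs_branch, Expr.eval, Expr.cost, uniformCost,
      Store.setVar_var, Store.setVar_arr, reduceIte, hv.card, hv.places]
    refine ⟨fun h => ⟨answers_of_known ?_ ?_, by omega⟩,
      fun h => ⟨answers_of_known ?_ ?_, by omega⟩⟩
    · simpa using hval
    · simp [h]
    · simpa using hval
    · simp only [Store.setVar_var, reduceIte, Nat.reduceEqDiff]
      rw [if_neg h]

theorem solve_haltsWithin (hk : 1 ≤ k) (Q : Fin k → List ℕ) (p : ℕ) :
    solve.HaltsWithin uniformCost (encode Q p) (500 * (k * (maxLength Q + 1) ^ k))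
      (Answers Q p) := by
  obtain ⟨s, t, he, ha, ht⟩ := runs_solve Q p
  refine ⟨s, t, he, ht.trans ?_, ha⟩
  have h₁ : stride Q k ≤ (maxLength Q + 1) ^ k := (stride_eq_card Q).trans_le (card_vertex_le Q)
  have h₂ : offset Q k ≤ k * maxLength Q := by
    rw [offset, Finset.sum_range]
    refine (Finset.sum_le_card_nsmul _ _ (maxLength Q) fun j _ => ?_).trans (by simp)
    rw [len_val]
    exact length_le_maxLength Q j
  have h₃ : maxLength Q + 1 ≤ (maxLength Q + 1) ^ k := Nat.le_self_pow (by omega) _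
  generalize (maxLength Q + 1) ^ k = M at *
  have h₄ : k * maxLength Q + k ≤ k * M := by
    rw [← mul_add_one]
    exact Nat.mul_le_mul_left k h₃
  have h₅ : k * stride Q k ≤ k * M := Nat.mul_le_mul_left k h₁
  have h₆ : M ≤ k * M := Nat.le_mul_of_pos_left M hk
  nlinarith

theorem maxLength_le_bitSize (Q : Fin k → List ℕ) (p : ℕ) :
    maxLength Q ≤ bitSize (encode Q p) := by
  refine (Finset.sup_le fun j _ => ?_).trans (length_le_bitSize _)
  have h : (Q j).length ≤ (bins Q).length :=
    (List.sublist_flatten_of_mem ((List.mem_ofFn' _ _).2 ⟨j, rfl⟩)).length_le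
  have h' : (encode Q p).length = k + (bins Q).length + 2 := by simp [encode, bins]
  omega

end StackUp

theorem mainTheorem5 :
    -- the processing graph and its min-max path values
    (∀ (k : ℕ), 1 ≤ k → ∀ (Q : Fin k → List ℕ), StackUp.TwoBinsPerPallet Q →
      StackUp.Acyclic (StackUp.processingGraph Q) ∧
      Fintype.card (StackUp.Vertex Q) ≤ (StackUp.maxLength Q + 1) ^ k ∧
      StackUp.val Q (StackUp.source Q) = ((StackUp.cut Q (StackUp.source Q)).card : ℕ∞) ∧
      (∀ v : StackUp.Vertex Q, v ≠ StackUp.source Q →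
        StackUp.val Q v =
          max ((StackUp.cut Q v).card : ℕ∞)
            (⨅ u ∈ {u : StackUp.Vertex Q | (StackUp.processingGraph Q).Adj u v},
              StackUp.val Q u)) ∧
      ∀ p : ℕ, 1 ≤ p →
        (StackUp.CanBeProcessed Q p ↔ StackUp.val Q (StackUp.target Q) ≤ (p : ℕ∞))) ∧
    -- one program, whose running time has a constant that depends on nothing
    ∃ (A : StackUp.Prog) (C : ℕ), ∀ (k : ℕ), 1 ≤ k →
      (∀ (Q : Fin k → List ℕ) (p : ℕ), StackUp.TwoBinsPerPallet Q → 1 ≤ p →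
        A.HaltsWithin StackUp.uniformCost (StackUp.encode Q p)
          (C * (k * (StackUp.maxLength Q + 1) ^ k)) (StackUp.Answers Q p)) ∧
      -- for fixed `k`, time polynomial in the number of bits of the input
      ∃ P : Polynomial ℕ, ∀ (Q : Fin k → List ℕ) (p : ℕ), StackUp.TwoBinsPerPallet Q → 1 ≤ p →
        A.HaltsWithin StackUp.logCost (StackUp.encode Q p)
          (P.eval (StackUp.bitSize (StackUp.encode Q p))) (StackUp.Answers Q p) := by
  refine ⟨fun k _ Q _ => ⟨StackUp.acyclic_processingGraph Q, StackUp.card_vertex_le Q,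
    StackUp.minMaxValue_self, fun v hv => StackUp.minMaxValue_eq_max hv,
    fun p _ => StackUp.canBeProcessed_iff Q p⟩, StackUp.solve, 500, fun k hk =>
    ⟨fun Q p _ _ => StackUp.solve_haltsWithin hk Q p, ?_⟩⟩
  let T : Polynomial ℕ := 500 * (Polynomial.C k * (Polynomial.X + 1) ^ k)
  refine ⟨T * (Polynomial.X + Polynomial.C StackUp.solve.constBits + 1 + T), fun Q p _ _ => ?_⟩
  obtain ⟨s, t, he, ht, ha⟩ := (StackUp.solve_haltsWithin hk Q p).logCost
  refine ⟨s, t, he, ht.trans ?_, ha⟩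
  have hN := StackUp.maxLength_le_bitSize Q p
  simp only [T, Polynomial.eval_mul, Polynomial.eval_add, Polynomial.eval_pow, Polynomial.eval_X,
    Polynomial.eval_C, Polynomial.eval_one, Polynomial.eval_ofNat]
  gcongr
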